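/- For $x\in\mathbb{R}^n$ let $x_{[1]}\ge x_{[2]}\ge\dots\ge x_{[n]}\ge 0$ be the non-increasing rearrangement of $|x_1|,\dots,|x_n|$, let $|x|$ be the Euclidean norm, let $\sum_{i=1}^{n/e}$ denote the sum over integers $1\le i\le n/e$, and put $0^0=1$. There are universal constants $C_0,C_1,C_2,C_3>0$ such that the following holds for all integers $n\ge 3$, all random vectors $X$ in $\mathbb{R}^n$ with the standard normal distribution, and all real $r\ge 0$, $p\ge 1$, $t>0$. In each of the cases below, with the $|\cdot|_\sharp$, $S$, $R$ given there, $$\mathbb{P}\{|X|_\sharp\le S\}\ \ge\ 1-C_0e^{-t^2/2},\qquad\text{and for all }x\in\mathbb{R}^n:\quad |x|_\sharp\le S\ \Longrightarrow\ \sum_{i=1}^n i^{-2r}x_{[i]}^{2(p-1)}\le R .$$ **Case I:** $p\ge 3/2$. Here $|x|_\sharp=\big(\sum_{i=1}^n i^{-2r}x_{[i]}^{2(p-1)}\big)^{1/(2(p-1))}$, which is a norm, $S\geq 0$, and $R=S^{2(p-1)}=A+Bt^{2(p-1)}$, where $$A=\frac{C_1^pp^pn^{1-2r}(\ln n)^p}{[p+(1-2r)\ln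 n]^p}\ \ (r\le 1/2),\qquad A=\frac{C_1^p(\ln n)^p}{1+(2r-1)\ln n}+C_1^p(\ln n)^{p-1}\ \ (r>1/2),$$ $$B=C_1\Big[1+\Big(\frac{\ln n}{1+|2-2r-p|\ln n}\Big)^{2-p}(1+n^{2-2r-p})\Big]\ \ (p<2),\qquad B=C_1^p\ \ (p\ge 2).$$ **Case II:** $1\le p<3/2$. Let $T=\sum_{i=1}^{n/e}i^{-2r}\big(\ln\frac ni+\frac{t^2}{i}\big)^{p-1}$ and $$|x|_\sharp=\sum_{i=1}^{n/e}\frac{i^{-2r}x_{[i]}}{\big(\ln\frac ni+\frac{t^2}{i}\big)^{(3-2p)/2}} .$$ For all $x$, $\sum_{i=1}^n i^{-2r}x_{[i]}^{2(p-1)}\le C_2T^{3-2p}|x|_\sharp^{2(p-1)}$. Here $S=C_1T$ and $R=C_2S$, and $R\le D+C_3\Big(1+\frac{1+n^{2-2r-p}}{1+|2-2r-p|\ln n}\ln n\Big)t^{2(p-1)}$, where $D=\frac{C_3n^{1-2r}(\ln n)^p}{[1+(1-2r)\ln n]^p}$ if $r\le 1/2$ and $D=C_3\Big(\frac{(\ln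 n)^p}{1+(2r-1)\ln n}+(\ln n)^{p-1}\Big)$ if $r>1/2$. If moreover $p\ge 3/2-2r$, then $|\cdot|_\sharp$ is a norm. **Case III:** $p<3/2-2r$ (so $r<1/4$ and $p<3/2$). Here $|x|_\sharp=\sum_{i=1}^n i^{-2r}x_{[i]}$, which is a norm. For all $x$, $\sum_{i=1}^n i^{-2r}x_{[i]}^{2(p-1)}\le C_2n^{(1-2r)(3-2p)}|x|_\sharp^{2(p-1)}$. Here $$S=C_1n^{1-2r}+C_1n^{\frac{1-4r}2}\Big(\frac{\ln n}{1+(1-4r)\ln n}\Big)^{1/2}t,$$ $$R=C_2n^{(1-2r)(3-2p)}S^{2(p-1)}\le C_3n^{1-2r}+C_3n^{2-2r-p}\Big(\frac{\ln n}{1+(1-4r)\ln n}\Big)^{p-1}t^{2(p-1)} .$$ **Case IVa:** $1/4<r\le 1/2$, $p=2(1-r)$ and $(1-2r)\ln n\ge e$ (so $1<p<3/2$). Let $\beta_i=\frac{(1-2r)^p\ln n}{n^{1-2r}}i^{-2r}\big(\ln\frac ni\big)^{p-1}+i^{-1}$ and $$|x|_\sharp=\sum_{i=1}^{n/e}\beta_i^{\frac{-(3-2p)}{2(p-1)}}i^{\frac{-r}{p-1}}x_{[i]}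 .$$ The coefficients $\beta_i^{-(3-2p)/(2(p-1))}i^{-r/(p-1)}$ are non-increasing in $i$ for $1\le i\le n/e$, and $|\cdot|_\sharp$ is a norm. For all $x$, $\sum_{i=1}^n i^{-2r}x_{[i]}^{2(p-1)}\le C_2(\ln n)^{3-2p}|x|_\sharp^{2(p-1)}$. Here $$S=C_1^{\frac1{p-1}}(1-2r)^{\frac{-p}{2(p-1)}}(\ln n)^{\frac{-(3-2p)}{2(p-1)}}n^{1/2}+C_1^{\frac1{p-1}}(\ln n)^{1/2}t,$$ $$R=C_2(\ln n)^{3-2p}S^{2(p-1)}\le C_3(1-2r)^{-1}n^{1-2r}+C_3(\ln n)^{2-p}t^{2(p-1)} .$$ **Case IVb:** $1/4<r\le 1/2$, $p=2(1-r)$ and $(1-2r)\ln n<e$ (so $p<3/2$). Here $|\cdot|_\sharp=|\cdot|$ is the Euclidean norm. For all $x$, $\sum_{i=1}^n i^{-2r}x_{[i]}^{2(p-1)}\le C_2(\ln n)|x|^{2(p-1)}$. Here $S=C_1n^{1/2}+t$ and $R=C_2(\ln n)S^{2(p-1)}\le C_3(\ln n)\big(1+t^{2(p-1)}\big)$; moreover,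 $R\le C_3(\ln n)t^{2(p-1)}$ when $t\ge 1$. -/

import Mathlib

open Real MeasureTheory ProbabilityTheory

noncomputable section

/-- The non-increasing rearrangement of the absolute values of the coordinates: `decr x i` is the
`i`-th largest of `|x_1|, …, |x_n|` for `1 ≤ i ≤ n` (indices start at `1`; the value at any other
index is irrelevant and set to `0`). -/
def decr {n : ℕ} (x : EuclideanSpace ℝ (Fin n)) (i : ℕ) : ℝ :=
  if h : 1 ≤ i ∧ i ≤ n then
    |x (Tuple.sort (fun j => -|x j|) ⟨i - 1, by omega⟩)|
  else 0

/-- The positive integers `i ≤ n / e`, the index range of the truncated sums. -/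
def upToNDivE (n : ℕ) : Finset ℕ := Finset.Icc 1 ⌊(n : ℝ) / Real.exp 1⌋₊

/-- `N` is a norm on `ℝⁿ`: a seminorm that vanishes only at `0`. -/
def IsNormOn {n : ℕ} (N : EuclideanSpace ℝ (Fin n) → ℝ) : Prop :=
  ∃ q : Seminorm ℝ (EuclideanSpace ℝ (Fin n)), (∀ x, q x = N x) ∧ ∀ x, N x = 0 → x = 0

/-- The functional `∑ i^{-2r} x_[i]^{2(p-1)}`, with `0 ^ 0 = 1` when `p = 1`. -/
def gradFun {n : ℕ} (r p : ℝ) (x : EuclideanSpace ℝ (Fin n)) : ℝ :=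
  ∑ i ∈ Finset.Icc 1 n, (i : ℝ) ^ (-(2 * r)) * decr x i ^ (2 * (p - 1))

/-! ### First regime: `p ≥ 3/2` -/

def normI {n : ℕ} (r p : ℝ) (x : EuclideanSpace ℝ (Fin n)) : ℝ :=
  (∑ i ∈ Finset.Icc 1 n, (i : ℝ) ^ (-(2 * r)) * decr x i ^ (2 * (p - 1))) ^ (1 / (2 * (p - 1)))

def coeffA (C : ℝ) (n : ℕ) (r p : ℝ) : ℝ :=
  if r ≤ 1 / 2 then
    C ^ p * p ^ p * (n : ℝ) ^ (1 - 2 * r) * Real.log n ^ p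
      / (p + (1 - 2 * r) * Real.log n) ^ p
  else
    C ^ p * Real.log n ^ p / (1 + (2 * r - 1) * Real.log n) + C ^ p * Real.log n ^ (p - 1)

def coeffB (C : ℝ) (n : ℕ) (r p : ℝ) : ℝ :=
  if p < 2 then
    C * (1 + (Real.log n / (1 + |2 - 2 * r - p| * Real.log n)) ^ (2 - p)
      * (1 + (n : ℝ) ^ (2 - 2 * r - p)))
  else C ^ p

/-- The bound `R = A + B t^{2(p-1)}`. -/
def boundI (C : ℝ) (n : ℕ) (r p t : ℝ) : ℝ :=
  coeffA C n r p + coeffB C n r p * t ^ (2 * (p - 1))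

/-- The threshold `S ≥ 0` with `S^{2(p-1)} = A + B t^{2(p-1)}`. -/
def threshI (C : ℝ) (n : ℕ) (r p t : ℝ) : ℝ :=
  boundI C n r p t ^ (1 / (2 * (p - 1)))

/-! ### Second regime: `1 ≤ p < 3/2` -/

/-- `∑_{i ≤ n/e} i^{-2r} (ln (n/i) + t²/i)^{p-1}` -/
def weightSum (n : ℕ) (r p t : ℝ) : ℝ :=
  ∑ i ∈ upToNDivE n,
    (i : ℝ) ^ (-(2 * r)) * (Real.log ((n : ℝ) / i) + t ^ 2 / i) ^ (p - 1)

def normII {n : ℕ} (r p t : ℝ) (x : EuclideanSpace ℝ (Fin n)) : ℝ :=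
  ∑ i ∈ upToNDivE n,
    (i : ℝ) ^ (-(2 * r)) * decr x i
      / (Real.log ((n : ℝ) / i) + t ^ 2 / i) ^ ((3 - 2 * p) / 2)

def threshII (C : ℝ) (n : ℕ) (r p t : ℝ) : ℝ := C * weightSum n r p t

/-- The explicit upper estimate for `R`. -/
def explicitII (C : ℝ) (n : ℕ) (r p t : ℝ) : ℝ :=
  (if r ≤ 1 / 2 then
      C * (n : ℝ) ^ (1 - 2 * r) * Real.log n ^ p / (1 + (1 - 2 * r) * Real.log n) ^ p
    else
      C * (Real.log n ^ p / (1 + (2 * r - 1) * Real.log n) + Real.log n ^ (p - 1)))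
  + C * (1 + (1 + (n : ℝ) ^ (2 - 2 * r - p)) / (1 + |2 - 2 * r - p| * Real.log n) * Real.log n)
      * t ^ (2 * (p - 1))

/-! ### Third regime: `p < 3/2 - 2r` -/

def normIII {n : ℕ} (r : ℝ) (x : EuclideanSpace ℝ (Fin n)) : ℝ :=
  ∑ i ∈ Finset.Icc 1 n, (i : ℝ) ^ (-(2 * r)) * decr x i

def threshIII (C : ℝ) (n : ℕ) (r t : ℝ) : ℝ :=
  C * (n : ℝ) ^ (1 - 2 * r)
    + C * (n : ℝ) ^ ((1 - 4 * r) / 2)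
      * (Real.log n / (1 + (1 - 4 * r) * Real.log n)) ^ (1 / 2 : ℝ) * t

def explicitIII (C : ℝ) (n : ℕ) (r p t : ℝ) : ℝ :=
  C * (n : ℝ) ^ (1 - 2 * r)
    + C * (n : ℝ) ^ (2 - 2 * r - p)
      * (Real.log n / (1 + (1 - 4 * r) * Real.log n)) ^ (p - 1) * t ^ (2 * (p - 1))

/-! ### Fourth regime: `1/4 < r ≤ 1/2`, `p = 2(1-r)`, first sub-case `(1-2r) ln n ≥ e` -/

def betaSeq (n : ℕ) (r p : ℝ) (i : ℕ) : ℝ :=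
  (1 - 2 * r) ^ p * Real.log n / (n : ℝ) ^ (1 - 2 * r)
      * (i : ℝ) ^ (-(2 * r)) * Real.log ((n : ℝ) / i) ^ (p - 1)
    + (i : ℝ)⁻¹

def coeffIVa (n : ℕ) (r p : ℝ) (i : ℕ) : ℝ :=
  betaSeq n r p i ^ (-(3 - 2 * p) / (2 * (p - 1))) * (i : ℝ) ^ (-r / (p - 1))

def normIVa {n : ℕ} (r p : ℝ) (x : EuclideanSpace ℝ (Fin n)) : ℝ :=
  ∑ i ∈ upToNDivE n, coeffIVa n r p i * decr x i

def threshIVa (C : ℝ) (n : ℕ) (r p t : ℝ) : ℝ :=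
  C ^ (1 / (p - 1)) * (1 - 2 * r) ^ (-p / (2 * (p - 1)))
      * Real.log n ^ (-(3 - 2 * p) / (2 * (p - 1))) * (n : ℝ) ^ (1 / 2 : ℝ)
    + C ^ (1 / (p - 1)) * Real.log n ^ (1 / 2 : ℝ) * t

def explicitIVa (C : ℝ) (n : ℕ) (r p t : ℝ) : ℝ :=
  C * (1 - 2 * r)⁻¹ * (n : ℝ) ^ (1 - 2 * r) + C * Real.log n ^ (2 - p) * t ^ (2 * (p - 1))

/-! ### Fourth regime, second sub-case `(1-2r) ln n < e` (Euclidean norm) -/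

def threshIVb (C : ℝ) (n : ℕ) (t : ℝ) : ℝ := C * (n : ℝ) ^ (1 / 2 : ℝ) + t

/-! ### The common conclusion -/

/-- The event `N(X) ≤ S` has probability at least `1 - C e^{-t²/2}`, and on the set `N ≤ S` the
functional `∑ i^{-2r} x_[i]^{2(p-1)}` is at most `R`. -/
def TailAndBound {n : ℕ} {Ω : Type*} [MeasurableSpace Ω] (P : Measure Ω)
    (X : Ω → EuclideanSpace ℝ (Fin n)) (C r p t : ℝ)
    (N : EuclideanSpace ℝ (Fin n) → ℝ) (S R : ℝ) : Prop :=
  1 - C * Real.exp (-t ^ 2 / 2) ≤ P.real {ω | N (X ω) ≤ S} ∧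
    ∀ x : EuclideanSpace ℝ (Fin n), N x ≤ S → gradFun r p x ≤ R

end

/-! ### Power sums -/

/-! Outside the Euclidean case, one probabilistic fact suffices. With probability at least 1 -
e^{-t²/2}, every set of m coordinates, for every 1 ≤ m ≤ n, has sum of squares at most 12(m(1 +
ln(n/m)) + t²). This is a chi-square Chernoff bound that beats the number of m-element sets, at most
exp(m(1 + ln(n/m))); see `stdGaussian_compl_typicalSet_le`. The rest is deterministic.

On this event let m be the largest index with m(1 + ln(n/m)) ≤ t². The m largest coordinates have
joint Euclidean norm O(t), and every later one satisfies x_[i]² = O(1 + ln(n/i))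
(`SumSqBound.exists_split`). For weights w ≥ 0 and 0 ≤ q < 2, Hölder on the first block and the
pointwise bound on the second give, up to constants, ∑ w_i x_[i]^q ≲ ‖w‖_{2/(2-q)} t^q + ∑ w_i (1 +
ln(n/i))^{q/2} (`SumSqBound.sum_rpow_le`). For q ≥ 2 and w ≤ 1 the inclusion of ℓ² in ℓ^q replaces
Hölder. What remains are power sums, with or without a logarithmic weight, estimated uniformly in
the exponent by comparing it with 1/ln n (`sum_rpow_sub_one_le_add`, `rpow_mul_log_sum_le`). Regime
II needs only the pointwise bound `SumSqBound.sq_le`.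

For p < 3/2 the functional is compared with a linear expression in the rearrangement through ∑ f^θ
g^{1-θ} ≤ (∑ f)^θ (∑ g)^{1-θ} with θ = 2(p-1); the choice of g produces the norms of regimes II, III
and IVa. In IVb the same inequality is used with θ = p-1, f = x_[i]² and g = 1/i. Weighted sums of
the rearrangement with non-increasing weights are norms because sorting maximises them over all
permutations (`isNormOn_weighted`).

Regime IVb asks for coefficient 1 in front of t, which the event above cannot give; there the
Chernoff parameter is optimised (`stdGaussian_norm_tail`). -/

lemma sum_rpow_sub_one_le {σ : ℝ} (h0 : 0 < σ) (h1 : σ ≤ 1) (n : ℕ) :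
    ∑ i ∈ Finset.Icc 1 n, (i : ℝ) ^ (σ - 1) ≤ (n : ℝ) ^ σ / σ := by
  induction n with
  | zero => simp [Real.zero_rpow h0.ne']
  | succ n ih =>
    rw [Finset.sum_Icc_succ_top (by omega)]
    refine (add_le_add_left ih _).trans ?_
    have hN : (0 : ℝ) < ((n + 1 : ℕ) : ℝ) := by positivity
    set N : ℝ := ((n + 1 : ℕ) : ℝ) with hNdef
    have hn : (n : ℝ) = N * (1 + -1 / N) := by
      field_simp; rw [hNdef]; push_cast; ring
    have hN1 : 1 ≤ N := by rw [hNdef]; push_cast; linarith [n.cast_nonneg (α := ℝ)]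
    have hs : -1 ≤ -1 / N := by
      rw [le_div_iff₀ hN]; linarith
    -- Bernoulli for exponents in [0,1], at increment -1/N: it says that n^σ/σ grows by at least
    -- N^{σ-1} from N-1 to N.
    have key := rpow_one_add_le_one_add_mul_self hs h0.le h1
    have e1 : (n : ℝ) ^ σ = N ^ σ * (1 + -1 / N) ^ σ := by
      rw [hn, Real.mul_rpow hN.le (by linarith)]
    have e2 : N ^ (σ - 1) = N ^ σ / N := by rw [Real.rpow_sub hN, Real.rpow_one]
    rw [e1, e2, div_add' _ _ _ h0.ne', div_le_div_iff_of_pos_right h0]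
    have := mul_le_mul_of_nonneg_left key (Real.rpow_nonneg hN.le σ)
    calc _ ≤ N ^ σ * (1 + σ * (-1 / N)) + N ^ σ / N * σ := by linarith
      _ = N ^ σ := by field_simp; ring

lemma sum_rpow_neg_sub_one_le {σ : ℝ} (h0 : 0 < σ) {n : ℕ} (hn : 1 ≤ n) :
    ∑ i ∈ Finset.Icc 1 n, (i : ℝ) ^ (-σ - 1) ≤ 1 + (1 - (n : ℝ) ^ (-σ)) / σ := by
  induction n, hn using Nat.le_induction with
  | base => simp
  | succ n hn ih =>
    rw [Finset.sum_Icc_succ_top (by omega)]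
    refine (add_le_add_left ih _).trans ?_
    have hn0 : (0 : ℝ) < n := by positivity
    have hN : (0 : ℝ) < ((n + 1 : ℕ) : ℝ) := by positivity
    set N : ℝ := ((n + 1 : ℕ) : ℝ) with hNdef
    have e2 : N ^ (-σ - 1) = N ^ (-σ) / N := by rw [Real.rpow_sub hN, Real.rpow_one]
    have e3 : (n : ℝ) ^ (-σ) = N ^ (-σ) * Real.exp (-σ * (Real.log n - Real.log N)) := by
      rw [Real.rpow_def_of_pos hn0, Real.rpow_def_of_pos hN, ← Real.exp_add]
      ring_nf
    have hlog : Real.log n - Real.log N ≤ - (1 / N) := by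
      rw [← Real.log_div hn0.ne' hN.ne']
      have := Real.log_le_sub_one_of_pos (div_pos hn0 hN)
      have e : (n : ℝ) / N - 1 = - (1 / N) := by
        field_simp; rw [hNdef]; push_cast; ring
      linarith
    have h4 : 1 + σ / N ≤ Real.exp (-σ * (Real.log n - Real.log N)) := by
      have h5 := Real.add_one_le_exp (-σ * (Real.log n - Real.log N))
      have h6 : σ * (1 / N) ≤ -σ * (Real.log n - Real.log N) := by nlinarith
      have : σ * (1 / N) = σ / N := by ring
      linarith
    have h7 := mul_le_mul_of_nonneg_left h4 (Real.rpow_nonneg hN.le (-σ))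
    rw [← e3] at h7
    rw [e2]
    have h8 : N ^ (-σ) / N = (N ^ (-σ) * (1 + σ / N) - N ^ (-σ)) / σ := by
      field_simp; ring
    rw [h8, add_assoc, ← add_div]
    gcongr
    linarith

lemma sum_inv_le_one_add_log (n : ℕ) :
    ∑ i ∈ Finset.Icc 1 n, (i : ℝ)⁻¹ ≤ 1 + Real.log n := by
  have := harmonic_le_one_add_log n
  rw [harmonic_eq_sum_Icc] at this
  push_cast at this
  exact this

lemma one_le_log_of_three_le {n : ℕ} (hn : 3 ≤ n) : 1 ≤ Real.log n := by
  rw [Real.le_log_iff_exp_le (by positivity)]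
  have : (3 : ℝ) ≤ n := by exact_mod_cast hn
  linarith [Real.exp_one_lt_three]

/-- The factor ln n/(1 + a ln n) is comparable to min(ln n, 1/a). If a ln n ≤ 1 the sum is compared
with the harmonic sum, otherwise with n^a/a, so the constant stays uniform as a tends to 0. -/
lemma sum_rpow_sub_one_le_mul_log {a : ℝ} (h0 : 0 ≤ a) (h1 : a ≤ 1) {n : ℕ} (hn : 3 ≤ n) :
    ∑ i ∈ Finset.Icc 1 n, (i : ℝ) ^ (a - 1)
      ≤ 4 * (n : ℝ) ^ a * (Real.log n / (1 + a * Real.log n)) := by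
  have hl := one_le_log_of_three_le hn
  have hn0 : (0 : ℝ) < n := by positivity
  have hna := Real.rpow_pos_of_pos hn0 a
  by_cases h : a * Real.log n ≤ 1
  · have h2 : ∑ i ∈ Finset.Icc 1 n, (i : ℝ) ^ (a - 1) ≤ (n : ℝ) ^ a * (1 + Real.log n) := by
      calc _ ≤ ∑ i ∈ Finset.Icc 1 n, (n : ℝ) ^ a * (i : ℝ)⁻¹ := by
            refine Finset.sum_le_sum fun i hi => ?_
            simp only [Finset.mem_Icc] at hi
            have hi0 : (0 : ℝ) < i := by exact_mod_cast hi.1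
            rw [Real.rpow_sub hi0, Real.rpow_one, div_eq_mul_inv]
            gcongr
            exact hi.2
        _ ≤ _ := by
            rw [← Finset.mul_sum]
            gcongr
            exact sum_inv_le_one_add_log n
    refine h2.trans ?_
    have h3 : Real.log n / 2 ≤ Real.log n / (1 + a * Real.log n) := by
      gcongr; linarith
    nlinarith
  · push Not at h
    have ha : 0 < a := by
      rcases h0.eq_or_lt with h' | h'
      · rw [← h'] at h; linarith
      · exact h'
    refine (sum_rpow_sub_one_le ha h1 n).trans ?_
    rw [mul_div_assoc', div_le_div_iff₀ ha (by positivity)]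
    nlinarith

lemma sum_rpow_sub_one_le_of_nonpos {a : ℝ} (h0 : a ≤ 0) {n : ℕ} (hn : 3 ≤ n) :
    ∑ i ∈ Finset.Icc 1 n, (i : ℝ) ^ (a - 1)
      ≤ 1 + 2 * (Real.log n / (1 + |a| * Real.log n)) := by
  have hl := one_le_log_of_three_le hn
  have hn0 : (0 : ℝ) < n := by positivity
  by_cases h : |a| * Real.log n ≤ 1
  · have h2 : ∑ i ∈ Finset.Icc 1 n, (i : ℝ) ^ (a - 1) ≤ 1 + Real.log n := by
      refine le_trans (Finset.sum_le_sum fun i hi => ?_) (sum_inv_le_one_add_log n)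
      simp only [Finset.mem_Icc] at hi
      rw [← Real.rpow_neg_one]
      exact Real.rpow_le_rpow_of_exponent_le (by exact_mod_cast hi.1) (by linarith)
    have h3 : Real.log n / 2 ≤ Real.log n / (1 + |a| * Real.log n) := by
      gcongr; linarith
    linarith
  · push Not at h
    have ha : 0 < -a := by
      rcases h0.eq_or_lt with h' | h'
      · rw [h'] at h; simp at h; linarith
      · linarith
    have h2 := sum_rpow_neg_sub_one_le ha (show 1 ≤ n by omega)
    rw [neg_neg] at h2
    rw [abs_of_nonpos h0] at h ⊢
    refine h2.trans ?_
    gcongr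
    rw [mul_div_assoc', div_le_div_iff₀ ha (by positivity)]
    have := Real.rpow_pos_of_pos hn0 a
    nlinarith

lemma sum_rpow_sub_one_le_add {a : ℝ} (h1 : a ≤ 1) {n : ℕ} (hn : 3 ≤ n) :
    ∑ i ∈ Finset.Icc 1 n, (i : ℝ) ^ (a - 1)
      ≤ 4 * (1 + (1 + (n : ℝ) ^ a) * (Real.log n / (1 + |a| * Real.log n))) := by
  have hl := one_le_log_of_three_le hn
  have hn0 : (0 : ℝ) < n := by positivity
  have hna := Real.rpow_pos_of_pos hn0 a
  rcases le_total 0 a with h | h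
  · refine (sum_rpow_sub_one_le_mul_log h h1 hn).trans ?_
    rw [abs_of_nonneg h]
    have : 0 ≤ Real.log n / (1 + a * Real.log n) := by positivity
    nlinarith
  · refine (sum_rpow_sub_one_le_of_nonpos h hn).trans ?_
    have : 0 ≤ Real.log n / (1 + |a| * Real.log n) := by positivity
    nlinarith

/-! ### Power sums with a logarithmic weight -/

lemma one_add_log_div_le {n i : ℕ} (hn : 3 ≤ n) (hi : 1 ≤ i) :
    1 + Real.log ((n : ℝ) / i) ≤ 2 * Real.log n := by
  have hl := one_le_log_of_three_le hn
  have hi0 : (1 : ℝ) ≤ i := by exact_mod_cast hi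
  have hn0 : (0 : ℝ) < n := by positivity
  rw [Real.log_div hn0.ne' (by linarith)]
  linarith [Real.log_nonneg hi0]

lemma one_le_one_add_log_div {n i : ℕ} (hi : 1 ≤ i) (hin : i ≤ n) :
    1 ≤ 1 + Real.log ((n : ℝ) / i) := by
  have hi0 : (0 : ℝ) < i := by exact_mod_cast hi
  have : (1 : ℝ) ≤ n / i := by rw [le_div_iff₀ hi0, one_mul]; exact_mod_cast hin
  linarith [Real.log_nonneg this]

/-- The power of the logarithm is absorbed by half of the exponent s: each term is at most a
constant times n^{s/2} i^{s/2-1}, and the remaining power sum has exponent s/2 > 0. -/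
lemma rpow_mul_log_sum_le_div {s p : ℝ} (hs : 0 < s) (hs1 : s ≤ 1) (hp : 1 ≤ p) {n : ℕ} :
    ∑ i ∈ Finset.Icc 1 n, (i : ℝ) ^ (s - 1) * (1 + Real.log ((n : ℝ) / i)) ^ (p - 1)
      ≤ 2 * (2 * p / s) ^ p * (n : ℝ) ^ s := by
  rcases Nat.eq_zero_or_pos n with rfl | hn
  · simp; positivity
  have hn0 : (0 : ℝ) < n := by positivity
  have hp0 : 0 < p := by linarith
  have h2p : 0 < 2 * p / s := by positivity
  have hexp : Real.exp (1 / 2) ≤ 2 := by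
    rw [← Real.le_log_iff_exp_le (by norm_num)]
    linarith [Real.log_two_gt_d9]
  have hterm : ∀ i ∈ Finset.Icc 1 n,
      (i : ℝ) ^ (s - 1) * (1 + Real.log ((n : ℝ) / i)) ^ (p - 1)
        ≤ 2 * (2 * p / s) ^ (p - 1) * (n : ℝ) ^ (s / 2) * (i : ℝ) ^ (s / 2 - 1) := by
    intro i hi
    simp only [Finset.mem_Icc] at hi
    have hi0 : (0 : ℝ) < i := by exact_mod_cast hi.1
    set u := Real.log ((n : ℝ) / i) with hu
    have hu0 : 0 ≤ u := by linarith [one_le_one_add_log_div hi.1 hi.2]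
    -- From z ≤ e^z at z = (1+u)s/(2p). The scale 2p/s is chosen so that raising to the power p-1
    -- costs at most e^{(1+u)s/2}; as s ≤ 1, the part e^{s/2} is at most √e ≤ 2.
    have h1 : 1 + u ≤ (2 * p / s) * Real.exp ((1 + u) / (2 * p / s)) := by
      have := Real.add_one_le_exp ((1 + u) / (2 * p / s))
      have h3 : 1 + u = (2 * p / s) * ((1 + u) / (2 * p / s)) := by field_simp
      calc 1 + u = (2 * p / s) * ((1 + u) / (2 * p / s)) := h3
        _ ≤ _ := by gcongr; linarith
    have h2 : (1 + u) ^ (p - 1)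
        ≤ (2 * p / s) ^ (p - 1) * (2 * Real.exp (u * (s / 2))) := by
      calc (1 + u) ^ (p - 1)
          ≤ ((2 * p / s) * Real.exp ((1 + u) / (2 * p / s))) ^ (p - 1) := by
            gcongr
        _ = (2 * p / s) ^ (p - 1) * Real.exp ((1 + u) / (2 * p / s) * (p - 1)) := by
            rw [Real.mul_rpow h2p.le (Real.exp_pos _).le, ← Real.exp_mul]
        _ ≤ (2 * p / s) ^ (p - 1) * Real.exp (1 / 2 + u * (s / 2)) := by
            gcongr
            have e : (1 + u) / (2 * p / s) * (p - 1) = (1 + u) * (s / 2) * ((p - 1) / p) := by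
              field_simp
            have h4 : (p - 1) / p ≤ 1 := by rw [div_le_one hp0]; linarith
            have h5 : 0 ≤ (1 + u) * (s / 2) := by positivity
            rw [e]
            nlinarith
        _ ≤ _ := by
            rw [Real.exp_add]; gcongr
    have h3 : Real.exp (u * (s / 2)) = (n : ℝ) ^ (s / 2) * (i : ℝ) ^ (-(s / 2)) := by
      rw [Real.rpow_neg hi0.le, ← div_eq_mul_inv, ← Real.div_rpow hn0.le hi0.le,
        Real.rpow_def_of_pos (by positivity)]
    rw [h3] at h2
    calc _ ≤ (i : ℝ) ^ (s - 1) * ((2 * p / s) ^ (p - 1)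
          * (2 * ((n : ℝ) ^ (s / 2) * (i : ℝ) ^ (-(s / 2))))) := by gcongr
      _ = 2 * (2 * p / s) ^ (p - 1) * (n : ℝ) ^ (s / 2)
          * ((i : ℝ) ^ (s - 1) * (i : ℝ) ^ (-(s / 2))) := by ring
      _ = _ := by rw [← Real.rpow_add hi0]; ring_nf
  refine (Finset.sum_le_sum hterm).trans ?_
  rw [← Finset.mul_sum]
  have h6 := sum_rpow_sub_one_le (σ := s / 2) (by positivity) (by linarith) n
  calc _ ≤ 2 * (2 * p / s) ^ (p - 1) * (n : ℝ) ^ (s / 2) * ((n : ℝ) ^ (s / 2) / (s / 2)) := by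
        gcongr
    _ = 2 * ((2 * p / s) ^ (p - 1) * (2 / s)) * ((n : ℝ) ^ (s / 2) * (n : ℝ) ^ (s / 2)) := by
        field_simp
    _ ≤ 2 * ((2 * p / s) ^ (p - 1) * (2 * p / s)) * ((n : ℝ) ^ (s / 2) * (n : ℝ) ^ (s / 2)) := by
        gcongr
        linarith
    _ = _ := by
        rw [← Real.rpow_add hn0, add_halves]
        congr 2
        nth_rw 2 [← Real.rpow_one (2 * p / s)]
        rw [← Real.rpow_add h2p, sub_add_cancel]

/-- Here p ln n/(p + s ln n) is comparable to min(ln n, p/s). For s ln n ≤ p the logarithm is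
bounded by its maximum and the harmonic sum remains; otherwise `rpow_mul_log_sum_le_div` applies. -/
lemma rpow_mul_log_sum_le {s p : ℝ} (hs : 0 ≤ s) (hs1 : s ≤ 1) (hp : 1 ≤ p) {n : ℕ}
    (hn : 3 ≤ n) :
    ∑ i ∈ Finset.Icc 1 n, (i : ℝ) ^ (s - 1) * (1 + Real.log ((n : ℝ) / i)) ^ (p - 1)
      ≤ 8 ^ p * (n : ℝ) ^ s * (p * Real.log n / (p + s * Real.log n)) ^ p := by
  have hn0 : (0 : ℝ) < n := by positivity
  have hp0 : 0 < p := by linarith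
  have hl := one_le_log_of_three_le hn
  by_cases h : s * Real.log n ≤ p
  · have h1 : Real.log n / 2 ≤ p * Real.log n / (p + s * Real.log n) := by
      rw [div_le_div_iff₀ (by norm_num) (by positivity)]
      nlinarith
    have h2 : ∑ i ∈ Finset.Icc 1 n, (i : ℝ) ^ (s - 1) * (1 + Real.log ((n : ℝ) / i)) ^ (p - 1)
        ≤ ∑ i ∈ Finset.Icc 1 n, (n : ℝ) ^ s * (2 * Real.log n) ^ (p - 1) * (i : ℝ)⁻¹ := by
      refine Finset.sum_le_sum fun i hi => ?_
      simp only [Finset.mem_Icc] at hi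
      have hi0 : (0 : ℝ) < i := by exact_mod_cast hi.1
      rw [Real.rpow_sub hi0, Real.rpow_one, div_eq_mul_inv, mul_right_comm]
      have := one_add_log_div_le hn hi.1
      have := one_le_one_add_log_div hi.1 hi.2
      gcongr
      · linarith
    refine h2.trans ?_
    rw [← Finset.mul_sum]
    calc _ ≤ (n : ℝ) ^ s * (2 * Real.log n) ^ (p - 1) * (2 * Real.log n) := by
          gcongr
          linarith [sum_inv_le_one_add_log n]
      _ = (n : ℝ) ^ s * (2 * Real.log n) ^ p := by
          have h2l : 0 < 2 * Real.log n := by positivity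
          rw [mul_assoc]
          congr 1
          nth_rw 2 [← Real.rpow_one (2 * Real.log n)]
          rw [← Real.rpow_add h2l, sub_add_cancel]
      _ ≤ (n : ℝ) ^ s * (8 * (p * Real.log n / (p + s * Real.log n))) ^ p := by
          have h3 : 2 * Real.log n ≤ 8 * (p * Real.log n / (p + s * Real.log n)) := by linarith
          gcongr
      _ = _ := by rw [Real.mul_rpow (by norm_num) (by positivity)]; ring
  · push Not at h
    have hs0 : 0 < s := by
      rcases hs.eq_or_lt with h' | h'
      · rw [← h'] at h; linarith
      · exact h'
    refine (rpow_mul_log_sum_le_div hs0 hs1 hp).trans ?_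
    have h1 : p / s / 2 ≤ p * Real.log n / (p + s * Real.log n) := by
      rw [div_div, div_le_div_iff₀ (by positivity) (by positivity)]
      nlinarith
    calc 2 * (2 * p / s) ^ p * (n : ℝ) ^ s ≤ 2 ^ p * (2 * p / s) ^ p * (n : ℝ) ^ s := by
          gcongr
          calc (2 : ℝ) = 2 ^ (1 : ℝ) := (Real.rpow_one 2).symm
            _ ≤ 2 ^ p := Real.rpow_le_rpow_of_exponent_le (by norm_num) hp
      _ = (2 * (2 * p / s)) ^ p * (n : ℝ) ^ s := by
          rw [Real.mul_rpow (by norm_num) (by positivity)]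
      _ ≤ (8 * (p * Real.log n / (p + s * Real.log n))) ^ p * (n : ℝ) ^ s := by
          have h3 : 2 * (2 * p / s) ≤ 8 * (p * Real.log n / (p + s * Real.log n)) := by
            have : 2 * (2 * p / s) = 8 * (p / s / 2) := by ring
            linarith
          gcongr
      _ = _ := by rw [Real.mul_rpow (by norm_num) (by positivity)]; ring

lemma rpow_neg_mul_log_sum_le {r p : ℝ} (hr : 1 / 2 < r) (hp : 1 ≤ p) {n : ℕ} (hn : 3 ≤ n) :
    ∑ i ∈ Finset.Icc 1 n, (i : ℝ) ^ (-(2 * r)) * (1 + Real.log ((n : ℝ) / i)) ^ (p - 1)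
      ≤ 2 ^ p * (Real.log n ^ p / (1 + (2 * r - 1) * Real.log n) + Real.log n ^ (p - 1)) := by
  have hl := one_le_log_of_three_le hn
  have h1 : ∀ i ∈ Finset.Icc 1 n,
      (i : ℝ) ^ (-(2 * r)) * (1 + Real.log ((n : ℝ) / i)) ^ (p - 1)
        ≤ (2 * Real.log n) ^ (p - 1) * (i : ℝ) ^ ((1 - 2 * r) - 1) := by
    intro i hi
    simp only [Finset.mem_Icc] at hi
    have := one_add_log_div_le hn hi.1
    have := one_le_one_add_log_div hi.1 hi.2
    rw [mul_comm, show 1 - 2 * r - 1 = -(2 * r) by ring]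
    gcongr
  refine (Finset.sum_le_sum h1).trans ?_
  rw [← Finset.mul_sum]
  have h2 := sum_rpow_sub_one_le_of_nonpos (a := 1 - 2 * r) (by linarith) hn
  rw [abs_of_neg (by linarith), neg_sub] at h2
  have hd : 0 < 1 + (2 * r - 1) * Real.log n := by nlinarith
  have e3 : Real.log n ^ p = Real.log n ^ (p - 1) * Real.log n := by
    nth_rw 3 [← Real.rpow_one (Real.log n)]
    rw [← Real.rpow_add (by linarith), sub_add_cancel]
  have e4 : (2 : ℝ) ^ p = 2 ^ (p - 1) * 2 := by
    nth_rw 3 [← Real.rpow_one 2]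
    rw [← Real.rpow_add (by norm_num), sub_add_cancel]
  rw [Real.mul_rpow (by norm_num) (by linarith), e3, e4]
  calc _ ≤ 2 ^ (p - 1) * Real.log n ^ (p - 1)
        * (1 + 2 * (Real.log n / (1 + (2 * r - 1) * Real.log n))) := by gcongr
    _ ≤ 2 ^ (p - 1) * Real.log n ^ (p - 1)
        * (2 * (Real.log n / (1 + (2 * r - 1) * Real.log n) + 1)) := by gcongr; linarith
    _ = _ := by ring

/-! ### Hölder's inequality -/

/-- Hölder in interpolation form. The endpoint θ = 0 is allowed because it occurs when p = 1, where
every f_i^0 equals 1. -/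
lemma sum_rpow_mul_rpow_le {ι : Type*} (s : Finset ι) {f g : ι → ℝ} {θ : ℝ} (h0 : 0 ≤ θ)
    (h1 : θ < 1) (hf : ∀ i ∈ s, 0 ≤ f i) (hg : ∀ i ∈ s, 0 ≤ g i) :
    ∑ i ∈ s, f i ^ θ * g i ^ (1 - θ) ≤ (∑ i ∈ s, f i) ^ θ * (∑ i ∈ s, g i) ^ (1 - θ) := by
  rcases h0.eq_or_lt with rfl | h0
  · simp
  have hc : Real.HolderConjugate (1 / θ) (1 / (1 - θ)) := by
    rw [Real.holderConjugate_iff]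
    refine ⟨by rw [lt_div_iff₀ h0]; linarith, by simp⟩
  have := Real.inner_le_Lp_mul_Lq_of_nonneg s hc (f := fun i => f i ^ θ)
    (g := fun i => g i ^ (1 - θ)) (fun i hi => Real.rpow_nonneg (hf i hi) _)
    (fun i hi => Real.rpow_nonneg (hg i hi) _)
  simp only [one_div_one_div] at this
  refine this.trans (le_of_eq ?_)
  congr 2
  · refine Finset.sum_congr rfl fun i hi => ?_
    rw [← Real.rpow_mul (hf i hi), mul_one_div_cancel h0.ne', Real.rpow_one]
  · refine Finset.sum_congr rfl fun i hi => ?_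
    rw [← Real.rpow_mul (hg i hi), mul_one_div_cancel (by linarith), Real.rpow_one]

/-! ### The non-increasing rearrangement -/

/-- The permutation that sorts the coordinates of `x` by non-increasing absolute value. -/
noncomputable def decrPerm {n : ℕ} (x : EuclideanSpace ℝ (Fin n)) : Equiv.Perm (Fin n) :=
  Tuple.sort (fun j => -|x j|)

lemma decr_succ {n : ℕ} (x : EuclideanSpace ℝ (Fin n)) (j : Fin n) :
    decr x (j + 1) = |x (decrPerm x j)| := by
  unfold decr decrPerm
  rw [dif_pos ⟨by omega, by omega⟩]
  rfl

lemma decr_nonneg {n : ℕ} (x : EuclideanSpace ℝ (Fin n)) (i : ℕ) : 0 ≤ decr x i := by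
  unfold decr
  split_ifs
  · exact abs_nonneg _
  · exact le_rfl

lemma antitone_abs_decrPerm {n : ℕ} (x : EuclideanSpace ℝ (Fin n)) :
    Antitone fun j => |x (decrPerm x j)| := by
  intro i j hij
  have := Tuple.monotone_sort (fun j => -|x j|) hij
  simp only [Function.comp] at this
  exact neg_le_neg_iff.mp this

lemma decr_le_decr {n : ℕ} (x : EuclideanSpace ℝ (Fin n)) {i j : ℕ} (hi : 1 ≤ i) (hij : i ≤ j)
    (hj : j ≤ n) : decr x j ≤ decr x i := by
  obtain ⟨a, rfl⟩ : ∃ a, i = a + 1 := ⟨i - 1, by omega⟩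
  obtain ⟨b, rfl⟩ : ∃ b, j = b + 1 := ⟨j - 1, by omega⟩
  have ha := decr_succ x ⟨a, by omega⟩
  have hb := decr_succ x ⟨b, by omega⟩
  simp only at ha hb
  rw [ha, hb]
  exact antitone_abs_decrPerm x (by simp; omega)

lemma sum_Icc_one_eq_sum_fin (n : ℕ) (f : ℕ → ℝ) :
    ∑ i ∈ Finset.Icc 1 n, f i = ∑ j : Fin n, f (j + 1) := by
  rw [Fin.sum_univ_eq_sum_range (fun j => f (j + 1)) n, Finset.range_eq_Ico,
    Finset.sum_Ico_add' f 0 n 1]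
  rfl

lemma sum_decr_sq_eq_norm_sq {n : ℕ} (x : EuclideanSpace ℝ (Fin n)) :
    ∑ i ∈ Finset.Icc 1 n, decr x i ^ 2 = ‖x‖ ^ 2 := by
  rw [sum_Icc_one_eq_sum_fin, EuclideanSpace.real_norm_sq_eq,
    ← Equiv.sum_comp (decrPerm x) (fun j => x j ^ 2)]
  simp [decr_succ]

/-- The set J collects the positions of the m largest entries. This lets bounds over all coordinate
subsets control the rearrangement. -/
lemma exists_finset_sum_decr_sq {n m : ℕ} (hm : m ≤ n) (x : EuclideanSpace ℝ (Fin n)) :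
    ∃ J : Finset (Fin n), J.card = m ∧
      ∑ i ∈ Finset.Icc 1 m, decr x i ^ 2 = ∑ j ∈ J, x j ^ 2 := by
  refine ⟨Finset.univ.map ((Fin.castLEEmb hm).trans (decrPerm x).toEmbedding), by simp, ?_⟩
  rw [Finset.sum_map, sum_Icc_one_eq_sum_fin]
  refine Finset.sum_congr rfl fun j _ => ?_
  have := decr_succ x (Fin.castLE hm j)
  simp only [Fin.val_castLE] at this
  rw [this, sq_abs]
  rfl

/-- The rearrangement inequality for the non-increasing rearrangement. -/
lemma sum_perm_le_sum_decr {n : ℕ} {w : ℕ → ℝ} {q : ℝ} (hq : 0 ≤ q)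
    (hw : ∀ i j, 1 ≤ i → i ≤ j → j ≤ n → w j ≤ w i)
    (x : EuclideanSpace ℝ (Fin n)) (τ : Equiv.Perm (Fin n)) :
    ∑ j : Fin n, w (j + 1) * |x (τ j)| ^ q ≤ ∑ i ∈ Finset.Icc 1 n, w i * decr x i ^ q := by
  rw [sum_Icc_one_eq_sum_fin]
  have hf : Antitone fun j : Fin n => w (j + 1) := fun i j hij =>
    hw _ _ (by omega) (by have : (i : ℕ) ≤ j := hij; omega) (by omega)
  have hg : Antitone fun j : Fin n => decr x (j + 1) ^ q := fun i j hij => by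
    simp only [decr_succ]
    exact Real.rpow_le_rpow (abs_nonneg _) (antitone_abs_decrPerm x hij) hq
  have := (hf.monovary hg).sum_mul_comp_perm_le_sum_mul (σ := τ.trans (decrPerm x).symm)
  refine le_trans (le_of_eq ?_) this
  simp [decr_succ]

lemma sum_Icc_ite_eq {n m : ℕ} (hmn : m ≤ n) (w f : ℕ → ℝ) :
    ∑ i ∈ Finset.Icc 1 n, (if i ≤ m then w i else 0) * f i = ∑ i ∈ Finset.Icc 1 m, w i * f i := by
  simp only [ite_mul, zero_mul]
  rw [← Finset.sum_filter]
  congr 1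
  ext i
  simp only [Finset.mem_filter, Finset.mem_Icc]
  omega

/-- By rearrangement the expression is the maximum over permutations τ of weighted ℓ^q norms of x∘τ,
each of which satisfies Minkowski's inequality. Definiteness needs only the first weight to be
positive, since it forces the largest entry to vanish. -/
lemma isNormOn_weighted_full {n : ℕ} (hn : 1 ≤ n) {w : ℕ → ℝ} {q : ℝ} (hq : 1 ≤ q)
    (hw : ∀ i j, 1 ≤ i → i ≤ j → j ≤ n → w j ≤ w i) (h0 : ∀ i, 1 ≤ i → i ≤ n → 0 ≤ w i)
    (h1 : 0 < w 1) :
    IsNormOn (n := n) (fun x => (∑ i ∈ Finset.Icc 1 n, w i * decr x i ^ q) ^ (1 / q)) := by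
  have hq0 : 0 < q := by linarith
  have hterm : ∀ (x : EuclideanSpace ℝ (Fin n)) (i), i ∈ Finset.Icc 1 n →
      0 ≤ w i * decr x i ^ q := fun x i hi => by
    rw [Finset.mem_Icc] at hi
    exact mul_nonneg (h0 i hi.1 hi.2) (Real.rpow_nonneg (decr_nonneg _ _) _)
  have hwj : ∀ j : Fin n, 0 ≤ w (j + 1) := fun j => h0 _ (by omega) (by omega)
  have hsum : ∀ x : EuclideanSpace ℝ (Fin n), ∑ i ∈ Finset.Icc 1 n, w i * decr x i ^ q
      = ∑ j : Fin n, w (j + 1) * |x (decrPerm x j)| ^ q := fun x => by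
    rw [sum_Icc_one_eq_sum_fin]; simp [decr_succ]
  refine ⟨Seminorm.ofSMulLE _ ?_ ?_ ?_, fun x => rfl, ?_⟩
  · rw [hsum]
    simp only [PiLp.zero_apply, abs_zero, Real.zero_rpow hq0.ne', mul_zero, Finset.sum_const_zero]
    exact Real.zero_rpow (by positivity)
  · intro x y
    rw [hsum]
    -- The permutation sorting x + y is applied to x and to y separately; by rearrangement neither
    -- value exceeds the sorted one.
    have hle : ∀ z : EuclideanSpace ℝ (Fin n), (∑ j : Fin n,
        (w (j + 1) ^ (1 / q) * |z (decrPerm (x + y) j)|) ^ q) ^ (1 / q)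
        ≤ (∑ i ∈ Finset.Icc 1 n, w i * decr z i ^ q) ^ (1 / q) := fun z => by
      refine Real.rpow_le_rpow (Finset.sum_nonneg fun j _ => ?_) ?_ (by positivity)
      · have := hwj j; positivity
      · refine le_trans (le_of_eq ?_) (sum_perm_le_sum_decr hq0.le hw z (decrPerm (x + y)))
        refine Finset.sum_congr rfl fun j _ => ?_
        rw [Real.mul_rpow (Real.rpow_nonneg (hwj j) _) (abs_nonneg _), ← Real.rpow_mul (hwj j),
          one_div_mul_cancel hq0.ne', Real.rpow_one]
    refine le_trans ?_ (add_le_add (hle x) (hle y))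
    refine le_trans ?_ (Real.Lp_add_le_of_nonneg _ hq (fun j _ => ?_) (fun j _ => ?_))
    · refine Real.rpow_le_rpow (Finset.sum_nonneg fun j _ => ?_)
        (Finset.sum_le_sum fun j _ => ?_) (by positivity)
      · have := hwj j; positivity
      · have h := hwj j
        rw [← mul_add, Real.mul_rpow (Real.rpow_nonneg h _) (by positivity),
          ← Real.rpow_mul h, one_div_mul_cancel hq0.ne', Real.rpow_one]
        gcongr
        exact abs_add_le _ _
    · have := hwj j; positivity
    · have := hwj j; positivity
  · intro c x
    rw [hsum]
    have : ∑ j : Fin n, w (j + 1) * |(c • x) (decrPerm (c • x) j)| ^ q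
        ≤ |c| ^ q * ∑ i ∈ Finset.Icc 1 n, w i * decr x i ^ q := by
      refine le_trans (le_of_eq ?_) (mul_le_mul_of_nonneg_left
        (sum_perm_le_sum_decr hq0.le hw x (decrPerm (c • x))) (by positivity))
      rw [Finset.mul_sum]
      refine Finset.sum_congr rfl fun j _ => ?_
      rw [PiLp.smul_apply, smul_eq_mul, abs_mul, Real.mul_rpow (abs_nonneg _) (abs_nonneg _)]
      ring
    refine (Real.rpow_le_rpow (Finset.sum_nonneg fun j _ => ?_) this (by positivity)).trans
      (le_of_eq ?_)
    · have := hwj j; positivity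
    · rw [Real.mul_rpow (by positivity) (Finset.sum_nonneg (hterm x)),
        ← Real.rpow_mul (abs_nonneg _), mul_one_div_cancel hq0.ne', Real.rpow_one]
      rfl
  · intro x hx
    have h2 : ∑ i ∈ Finset.Icc 1 n, w i * decr x i ^ q = 0 := by
      rw [Real.rpow_eq_zero (Finset.sum_nonneg (hterm x)) (by positivity)] at hx
      exact hx
    rw [Finset.sum_eq_zero_iff_of_nonneg (hterm x)] at h2
    have h3 := h2 1 (by simp [hn])
    rw [mul_eq_zero, or_iff_right h1.ne', Real.rpow_eq_zero (decr_nonneg _ _) hq0.ne'] at h3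
    ext j
    have h4 := decr_succ x ((decrPerm x).symm j)
    rw [Equiv.apply_symm_apply] at h4
    have h5 := decr_le_decr x (i := 1) (j := ((decrPerm x).symm j : ℕ) + 1) le_rfl (by omega)
      (by omega)
    rw [h4, h3] at h5
    simpa using h5

lemma isNormOn_weighted {n m : ℕ} (hm : 1 ≤ m) (hmn : m ≤ n) {w : ℕ → ℝ} {q : ℝ} (hq : 1 ≤ q)
    (hw : ∀ i j, 1 ≤ i → i ≤ j → j ≤ m → w j ≤ w i) (h0 : ∀ i, 1 ≤ i → i ≤ m → 0 ≤ w i)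
    (h1 : 0 < w 1) :
    IsNormOn (n := n) (fun x => (∑ i ∈ Finset.Icc 1 m, w i * decr x i ^ q) ^ (1 / q)) := by
  -- A truncated sum is a full sum whose weights are extended by zero, which keeps them
  -- non-increasing.
  have := isNormOn_weighted_full (n := n) (by omega) (w := fun i => if i ≤ m then w i else 0)
    hq (fun i j hi hij hj => ?_) (fun i hi hin => ?_) (by simp [hm, h1])
  · simpa only [sum_Icc_ite_eq hmn] using this
  · split_ifs with h2 h3
    · exact hw i j hi hij h2
    · omega
    · exact h0 i hi (by assumption)
    · exact le_rfl
  · split_ifs with h2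
    · exact h0 i hi h2
    · exact le_rfl

lemma isNormOn_weighted_one {n m : ℕ} (hm : 1 ≤ m) (hmn : m ≤ n) {w : ℕ → ℝ}
    (hw : ∀ i j, 1 ≤ i → i ≤ j → j ≤ m → w j ≤ w i) (h0 : ∀ i, 1 ≤ i → i ≤ m → 0 ≤ w i)
    (h1 : 0 < w 1) :
    IsNormOn (n := n) (fun x => ∑ i ∈ Finset.Icc 1 m, w i * decr x i) := by
  simpa using isNormOn_weighted hm hmn le_rfl hw h0 h1

/-! ### The range `i ≤ n / e` -/

lemma one_le_floor_div_exp {n : ℕ} (hn : 3 ≤ n) : 1 ≤ ⌊(n : ℝ) / Real.exp 1⌋₊ := by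
  rw [Nat.le_floor_iff (by positivity), le_div_iff₀ (Real.exp_pos 1)]
  have : (3 : ℝ) ≤ n := by exact_mod_cast hn
  push_cast
  linarith [Real.exp_one_lt_three]

lemma floor_div_exp_le (n : ℕ) : ⌊(n : ℝ) / Real.exp 1⌋₊ ≤ n := by
  have h : (n : ℝ) / Real.exp 1 ≤ n := by
    apply div_le_self (by positivity)
    linarith [Real.add_one_le_exp 1]
  exact Nat.floor_le_of_le h

lemma mem_upToNDivE {n i : ℕ} : i ∈ upToNDivE n ↔ 1 ≤ i ∧ (i : ℝ) ≤ n / Real.exp 1 := by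
  unfold upToNDivE
  rw [Finset.mem_Icc, Nat.le_floor_iff (by positivity)]

lemma upToNDivE_subset (n : ℕ) : upToNDivE n ⊆ Finset.Icc 1 n :=
  Finset.Icc_subset_Icc_right (floor_div_exp_le n)

lemma one_le_log_div {n i : ℕ} (hi : i ∈ upToNDivE n) : 1 ≤ Real.log ((n : ℝ) / i) := by
  rw [mem_upToNDivE] at hi
  have hi0 : (0 : ℝ) < i := by exact_mod_cast hi.1
  have h2 := hi.2
  rw [le_div_iff₀ (Real.exp_pos 1)] at h2
  have hn : (0 : ℝ) < n := lt_of_lt_of_le (by positivity) h2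
  rw [Real.le_log_iff_exp_le (by positivity), le_div_iff₀ hi0, mul_comm]
  exact h2

lemma sum_le_six_mul_sum_upToNDivE {n : ℕ} (hn : 3 ≤ n) {f : ℕ → ℝ}
    (hf : ∀ i j, 1 ≤ i → i ≤ j → j ≤ n → f j ≤ f i) (h0 : ∀ i, 1 ≤ i → i ≤ n → 0 ≤ f i) :
    ∑ i ∈ Finset.Icc 1 n, f i ≤ 6 * ∑ i ∈ upToNDivE n, f i := by
  unfold upToNDivE
  set m := ⌊(n : ℝ) / Real.exp 1⌋₊ with hm
  have h1 : 1 ≤ m := one_le_floor_div_exp hn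
  have hmn : m ≤ n := floor_div_exp_le n
  -- Since m ≥ 1, n < e(m+1) ≤ 2em < 6m. The tail thus has at most 5m terms, each at most the m-th,
  -- and m times the m-th term is at most the head.
  have hlt : n ≤ 6 * m := by
    have h2 := Nat.lt_floor_add_one ((n : ℝ) / Real.exp 1)
    rw [← hm, div_lt_iff₀ (Real.exp_pos 1)] at h2
    have h3 : (1 : ℝ) ≤ m := by exact_mod_cast h1
    have h4 : (n : ℝ) ≤ 6 * m := by nlinarith [Real.exp_one_lt_three, Real.exp_pos 1]
    exact_mod_cast h4
  have h5 : m * f m ≤ ∑ i ∈ Finset.Icc 1 m, f i := by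
    have := Finset.card_nsmul_le_sum (Finset.Icc 1 m) f (f m) fun i hi => by
      rw [Finset.mem_Icc] at hi
      exact hf i m hi.1 hi.2 hmn
    simpa using this
  have h6 : ∑ i ∈ Finset.Ioc m n, f i ≤ (n - m : ℕ) * f m := by
    have := Finset.sum_le_card_nsmul (Finset.Ioc m n) f (f m) fun i hi => by
      rw [Finset.mem_Ioc] at hi
      exact hf m i h1 hi.1.le hi.2
    simpa using this
  have h7 : ∑ i ∈ Finset.Icc 1 n, f i
      = ∑ i ∈ Finset.Icc 1 m, f i + ∑ i ∈ Finset.Ioc m n, f i := by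
    have := Finset.sum_Ioc_consecutive f (Nat.zero_le m) hmn
    exact this.symm
  have h8 : ((n - m : ℕ) : ℝ) ≤ 5 * m := by
    have : n - m ≤ 5 * m := by omega
    exact_mod_cast this
  have h9 := h0 m h1 hmn
  nlinarith [mul_le_mul_of_nonneg_right h8 h9]

/-! ### The deterministic consequences of a bound on partial sums of squares -/

/-- All partial sums of squares of a sequence are controlled as for a typical Gaussian vector. -/
def SumSqBound (n : ℕ) (K t : ℝ) (y : ℕ → ℝ) : Prop :=
  ∀ m, 1 ≤ m → m ≤ n →
    ∑ i ∈ Finset.Icc 1 m, y i ^ 2 ≤ K * (m * (1 + Real.log ((n : ℝ) / m)) + t ^ 2)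

/-- For a non-increasing sequence, i·y_i² is at most the sum of the first i squares. -/
lemma SumSqBound.sq_le {n : ℕ} {K t : ℝ} {y : ℕ → ℝ} (h : SumSqBound n K t y)
    (h0 : ∀ i, 0 ≤ y i) (hy : ∀ i j, 1 ≤ i → i ≤ j → j ≤ n → y j ≤ y i) {i : ℕ} (hi : 1 ≤ i)
    (hin : i ≤ n) : y i ^ 2 ≤ K * (1 + Real.log ((n : ℝ) / i) + t ^ 2 / i) := by
  have hi0 : (0 : ℝ) < i := by exact_mod_cast hi
  have h5 : i * y i ^ 2 ≤ ∑ j ∈ Finset.Icc 1 i, y j ^ 2 := by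
    have := Finset.card_nsmul_le_sum (Finset.Icc 1 i) (fun j => y j ^ 2) (y i ^ 2) fun j hj => by
      rw [Finset.mem_Icc] at hj
      exact pow_le_pow_left₀ (h0 i) (hy j i hj.1 hj.2 hin) 2
    simpa using this
  have := h5.trans (h i hi hin)
  rw [← mul_le_mul_iff_right₀ hi0]
  refine this.trans (le_of_eq ?_)
  field_simp

lemma SumSqBound.exists_split {n : ℕ} {K t : ℝ} {y : ℕ → ℝ} (hK : 0 ≤ K)
    (h : SumSqBound n K t y)
    (h0 : ∀ i, 0 ≤ y i) (hy : ∀ i j, 1 ≤ i → i ≤ j → j ≤ n → y j ≤ y i) :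
    ∃ m ≤ n, ∑ i ∈ Finset.Icc 1 m, y i ^ 2 ≤ 2 * K * t ^ 2 ∧
      ∀ i, m < i → i ≤ n → y i ^ 2 ≤ 2 * K * (1 + Real.log ((n : ℝ) / i)) := by
  classical
  let S := (Finset.range (n + 1)).filter fun m : ℕ =>
    (m : ℝ) * (1 + Real.log ((n : ℝ) / m)) ≤ t ^ 2
  -- The index 0 qualifies because its left-hand side is multiplied by 0; it covers the case where t
  -- is too small for any block.
  have hS : S.Nonempty := ⟨0, by simp [S]; positivity⟩
  have hmem := Finset.max'_mem S hS
  set m := S.max' hS with hm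
  simp only [S, Finset.mem_filter, Finset.mem_range] at hmem
  refine ⟨m, by omega, ?_, fun i hi hin => ?_⟩
  · rcases Nat.eq_zero_or_pos m with h' | h'
    · rw [h']; simp; positivity
    · refine (h m h' (by omega)).trans ?_
      nlinarith [hmem.2]
  · have hi0 : (0 : ℝ) < i := by
      have : 0 < i := by omega
      exact_mod_cast this
    -- Maximality of m is all that is used, so no monotonicity of i(1 + ln(n/i)) is required.
    have hnot : ¬ ((i : ℝ) * (1 + Real.log ((n : ℝ) / i)) ≤ t ^ 2) := fun hc => by
      have : i ∈ S := by simp only [S, Finset.mem_filter, Finset.mem_range]; exact ⟨by omega, hc⟩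
      have := S.le_max' i this
      omega
    push Not at hnot
    refine (h.sq_le h0 hy (by omega) hin).trans ?_
    have : t ^ 2 / i ≤ 1 + Real.log ((n : ℝ) / i) := by
      rw [div_le_iff₀ hi0]; linarith
    nlinarith

lemma SumSqBound.exists_sum_le {n : ℕ} {K t : ℝ} {y : ℕ → ℝ} (hK : 0 ≤ K)
    (h : SumSqBound n K t y)
    (h0 : ∀ i, 0 ≤ y i) (hy : ∀ i j, 1 ≤ i → i ≤ j → j ≤ n → y j ≤ y i)
    {s : Finset ℕ} (hs : s ⊆ Finset.Icc 1 n) {w : ℕ → ℝ} (hw : ∀ i ∈ s, 0 ≤ w i) {q : ℝ}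
    (hq : 0 ≤ q) :
    ∃ m ≤ n, ∑ i ∈ Finset.Icc 1 m, y i ^ 2 ≤ 2 * K * t ^ 2 ∧
      ∑ i ∈ s, w i * y i ^ q ≤ ∑ i ∈ s with i ≤ m, w i * y i ^ q
        + (2 * K) ^ (q / 2) * ∑ i ∈ s, w i * (1 + Real.log ((n : ℝ) / i)) ^ (q / 2) := by
  obtain ⟨m, hm, h1, h2⟩ := h.exists_split hK h0 hy
  refine ⟨m, hm, h1, ?_⟩
  rw [← Finset.sum_filter_add_sum_filter_not s (fun i => i ≤ m)]
  refine add_le_add le_rfl ?_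
  rw [Finset.mul_sum]
  refine le_trans ?_ (Finset.sum_le_sum_of_subset_of_nonneg
    (Finset.filter_subset (fun i => ¬ i ≤ m) s) ?_)
  · refine Finset.sum_le_sum fun i hi => ?_
    rw [Finset.mem_filter] at hi
    have hi' := Finset.mem_Icc.mp (hs hi.1)
    have h3 := h2 i (by omega) hi'.2
    have h4 := one_le_one_add_log_div hi'.1 hi'.2
    have h5 : y i ^ q = (y i ^ 2) ^ (q / 2) := by
      rw [← Real.rpow_natCast, ← Real.rpow_mul (h0 i)]; congr 1; push_cast; ring
    rw [h5, mul_left_comm, ← Real.mul_rpow (by positivity) (by linarith)]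
    have := hw i hi.1
    gcongr
  · intro i hi _
    have hi' := Finset.mem_Icc.mp (hs hi)
    have h4 := one_le_one_add_log_div hi'.1 hi'.2
    have := hw i hi
    have : 0 ≤ 1 + Real.log ((n : ℝ) / i) := by linarith
    positivity

lemma SumSqBound.sum_rpow_le {n : ℕ} {K t : ℝ} {y : ℕ → ℝ} (hK : 0 ≤ K) (ht : 0 ≤ t)
    (h : SumSqBound n K t y)
    (h0 : ∀ i, 0 ≤ y i) (hy : ∀ i j, 1 ≤ i → i ≤ j → j ≤ n → y j ≤ y i)
    {s : Finset ℕ} (hs : s ⊆ Finset.Icc 1 n) {w : ℕ → ℝ} (hw : ∀ i ∈ s, 0 ≤ w i) {q : ℝ}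
    (hq : 0 ≤ q) (hq2 : q < 2) :
    ∑ i ∈ s, w i * y i ^ q ≤ (2 * K) ^ (q / 2) *
      ((∑ i ∈ s, w i ^ (1 / (1 - q / 2))) ^ (1 - q / 2) * t ^ q
        + ∑ i ∈ s, w i * (1 + Real.log ((n : ℝ) / i)) ^ (q / 2)) := by
  obtain ⟨m, hm, h1, h2⟩ := h.exists_sum_le hK h0 hy hs hw hq
  refine h2.trans ?_
  rw [mul_add]
  refine add_le_add ?_ le_rfl
  have hθ : 0 < 1 - q / 2 := by linarith
  calc ∑ i ∈ s with i ≤ m, w i * y i ^ q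
      -- Hölder with θ = q/2: the squares carry the bound 2Kt², and the exponent 1/(1-q/2) on the
      -- weights is its dual.
      = ∑ i ∈ s with i ≤ m, (y i ^ 2) ^ (q / 2) * (w i ^ (1 / (1 - q / 2))) ^ (1 - q / 2) := by
        refine Finset.sum_congr rfl fun i hi => ?_
        rw [Finset.mem_filter] at hi
        rw [← Real.rpow_mul (hw i hi.1), one_div_mul_cancel hθ.ne', Real.rpow_one,
          ← Real.rpow_natCast, ← Real.rpow_mul (h0 i), mul_comm]
        congr 2; push_cast; ring
    _ ≤ (∑ i ∈ s with i ≤ m, y i ^ 2) ^ (q / 2)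
        * (∑ i ∈ s with i ≤ m, w i ^ (1 / (1 - q / 2))) ^ (1 - q / 2) := by
        refine sum_rpow_mul_rpow_le _ (by linarith) (by linarith) (fun i _ => sq_nonneg _)
          fun i hi => Real.rpow_nonneg (hw i (Finset.mem_filter.mp hi).1) _
    _ ≤ (2 * K * t ^ 2) ^ (q / 2) * (∑ i ∈ s, w i ^ (1 / (1 - q / 2))) ^ (1 - q / 2) := by
        have h3 : ∑ i ∈ s with i ≤ m, y i ^ 2 ≤ 2 * K * t ^ 2 := by
          refine le_trans (Finset.sum_le_sum_of_subset_of_nonneg ?_ fun i _ _ => sq_nonneg _) h1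
          intro i hi
          rw [Finset.mem_filter] at hi
          have hi' := Finset.mem_Icc.mp (hs hi.1)
          rw [Finset.mem_Icc]
          omega
        have h4 : ∑ i ∈ s with i ≤ m, w i ^ (1 / (1 - q / 2)) ≤ ∑ i ∈ s, w i ^ (1 / (1 - q / 2)) :=
          Finset.sum_le_sum_of_subset_of_nonneg (Finset.filter_subset _ s) fun i hi _ =>
            Real.rpow_nonneg (hw i hi) _
        have h5 : 0 ≤ ∑ i ∈ s with i ≤ m, w i ^ (1 / (1 - q / 2)) :=
          Finset.sum_nonneg fun i hi => Real.rpow_nonneg (hw i (Finset.mem_filter.mp hi).1) _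
        have h6 : 0 ≤ ∑ i ∈ s with i ≤ m, y i ^ 2 := Finset.sum_nonneg fun i _ => sq_nonneg _
        exact mul_le_mul (Real.rpow_le_rpow h6 h3 (by linarith))
          (Real.rpow_le_rpow h5 h4 hθ.le) (Real.rpow_nonneg h5 _) (by positivity)
    _ = _ := by
        rw [Real.mul_rpow (by positivity) (by positivity), ← Real.rpow_natCast t 2,
          ← Real.rpow_mul ht]
        have : ((2 : ℕ) : ℝ) * (q / 2) = q := by push_cast; ring
        rw [this]
        ring

/-- Write f_i^a = f_i · f_i^{a-1} and bound the second factor by the (a-1)-th power of the whole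
sum. -/
lemma sum_rpow_le_sum_rpow {ι : Type*} (s : Finset ι) {f : ι → ℝ} (hf : ∀ i ∈ s, 0 ≤ f i)
    {a : ℝ} (ha : 1 ≤ a) : ∑ i ∈ s, f i ^ a ≤ (∑ i ∈ s, f i) ^ a := by
  have hS := Finset.sum_nonneg hf
  have e : ∀ z : ℝ, 0 ≤ z → z ^ a = z * z ^ (a - 1) := fun z hz => by
    rcases hz.eq_or_lt with rfl | hz
    · rw [Real.zero_rpow (by linarith), zero_mul]
    · rw [Real.rpow_sub hz, Real.rpow_one]; field_simp
  rw [e _ hS, Finset.sum_mul]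
  refine Finset.sum_le_sum fun i hi => ?_
  rw [e _ (hf i hi)]
  have := hf i hi
  gcongr
  · exact Finset.single_le_sum hf hi

lemma SumSqBound.sum_rpow_le_of_two_le {n : ℕ} {K t : ℝ} {y : ℕ → ℝ} (hK : 0 ≤ K) (ht : 0 ≤ t)
    (h : SumSqBound n K t y)
    (h0 : ∀ i, 0 ≤ y i) (hy : ∀ i j, 1 ≤ i → i ≤ j → j ≤ n → y j ≤ y i)
    {w : ℕ → ℝ} (hw : ∀ i ∈ Finset.Icc 1 n, 0 ≤ w i)
    (hw1 : ∀ i ∈ Finset.Icc 1 n, w i ≤ 1) {q : ℝ} (hq2 : 2 ≤ q) :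
    ∑ i ∈ Finset.Icc 1 n, w i * y i ^ q ≤ (2 * K) ^ (q / 2) *
      (t ^ q + ∑ i ∈ Finset.Icc 1 n, w i * (1 + Real.log ((n : ℝ) / i)) ^ (q / 2)) := by
  obtain ⟨m, hm, h1, h2⟩ := h.exists_sum_le hK h0 hy subset_rfl hw (by linarith)
  refine h2.trans ?_
  rw [mul_add]
  refine add_le_add ?_ le_rfl
  have hfil : (Finset.Icc 1 n).filter (fun i => i ≤ m) ⊆ Finset.Icc 1 m := by
    intro i hi
    rw [Finset.mem_filter, Finset.mem_Icc] at hi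
    rw [Finset.mem_Icc]
    omega
  calc ∑ i ∈ Finset.Icc 1 n with i ≤ m, w i * y i ^ q
      ≤ ∑ i ∈ Finset.Icc 1 n with i ≤ m, (y i ^ 2) ^ (q / 2) := by
        refine Finset.sum_le_sum fun i hi => ?_
        rw [Finset.mem_filter] at hi
        have h5 : (y i ^ 2) ^ (q / 2) = y i ^ q := by
          rw [← Real.rpow_natCast, ← Real.rpow_mul (h0 i)]; congr 1; push_cast; ring
        rw [h5]
        exact mul_le_of_le_one_left (Real.rpow_nonneg (h0 i) _) (hw1 i hi.1)
    _ ≤ (∑ i ∈ Finset.Icc 1 n with i ≤ m, y i ^ 2) ^ (q / 2) :=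
        sum_rpow_le_sum_rpow _ (fun i _ => sq_nonneg _) (by linarith)
    _ ≤ (2 * K * t ^ 2) ^ (q / 2) := by
        gcongr
        exact (Finset.sum_le_sum_of_subset_of_nonneg hfil fun i _ _ => sq_nonneg _).trans h1
    _ = _ := by
        rw [Real.mul_rpow (by positivity) (by positivity), ← Real.rpow_natCast t 2,
          ← Real.rpow_mul ht]
        congr 2; push_cast; ring

/-! ### Chi-square tails -/

lemma integral_exp_mul_sq_gaussianReal {a : ℝ} (ha : a < 1 / 2) :
    ∫ x, Real.exp (a * x ^ 2) ∂(gaussianReal 0 1) = (1 - 2 * a) ^ (-(1 / 2) : ℝ) := by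
  rw [integral_gaussianReal_eq_integral_smul (by norm_num)]
  have h : ∀ x : ℝ, gaussianPDFReal 0 1 x • Real.exp (a * x ^ 2)
      = (√(2 * π))⁻¹ * Real.exp (-(1 / 2 - a) * x ^ 2) := fun x => by
    rw [gaussianPDFReal, smul_eq_mul, mul_assoc, ← Real.exp_add]
    simp only [NNReal.coe_one, mul_one, sub_zero]
    congr 2
    ring
  simp_rw [h]
  rw [integral_const_mul, integral_gaussian, ← Real.sqrt_inv, ← Real.sqrt_mul (by positivity),
    Real.rpow_neg (by linarith), ← Real.sqrt_eq_rpow, ← Real.sqrt_inv]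
  congr 1
  have : 1 / 2 - a ≠ 0 := by linarith
  have : 1 - 2 * a ≠ 0 := by linarith
  field_simp

/-- The Bochner integral of a non-integrable function is 0, whereas the value already computed is
positive. -/
lemma integrable_exp_mul_sq_gaussianReal {a : ℝ} (ha : a < 1 / 2) :
    Integrable (fun x => Real.exp (a * x ^ 2)) (gaussianReal 0 1) := by
  by_contra h
  have h1 := integral_exp_mul_sq_gaussianReal ha
  rw [integral_undef h] at h1
  have : 0 < (1 - 2 * a) ^ (-(1 / 2) : ℝ) := Real.rpow_pos_of_pos (by linarith) _
  linarith

lemma exp_mul_sum_sq_eq_prod {n : ℕ} (J : Finset (Fin n)) (a : ℝ) (x : Fin n → ℝ) :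
    Real.exp (a * ∑ j ∈ J, x j ^ 2) = ∏ j, if j ∈ J then Real.exp (a * x j ^ 2) else 1 := by
  rw [Finset.mul_sum, Real.exp_sum, Finset.prod_ite_mem, Finset.univ_inter]

lemma integrable_exp_mul_sum_sq {n : ℕ} (J : Finset (Fin n)) {a : ℝ} (ha : a < 1 / 2) :
    Integrable (fun x : EuclideanSpace ℝ (Fin n) => Real.exp (a * ∑ j ∈ J, x j ^ 2))
      (stdGaussian (EuclideanSpace ℝ (Fin n))) := by
  rw [← map_pi_eq_stdGaussian, integrable_map_measure (by fun_prop) (by fun_prop)]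
  simp only [Function.comp_def, exp_mul_sum_sq_eq_prod]
  refine Integrable.fintype_prod (f := fun j x => if j ∈ J then Real.exp (a * x ^ 2) else 1)
    fun j => ?_
  split_ifs
  · exact integrable_exp_mul_sq_gaussianReal ha
  · exact integrable_const _

/-- Independence of the coordinates factors the integral; coordinates outside J contribute 1. -/
lemma integral_exp_mul_sum_sq {n : ℕ} (J : Finset (Fin n)) {a : ℝ} (ha : a < 1 / 2) :
    ∫ x : EuclideanSpace ℝ (Fin n), Real.exp (a * ∑ j ∈ J, x j ^ 2)
      ∂(stdGaussian (EuclideanSpace ℝ (Fin n))) = (1 - 2 * a) ^ (-(J.card / 2) : ℝ) := by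
  rw [← map_pi_eq_stdGaussian, integral_map (by fun_prop) (by fun_prop)]
  simp only [exp_mul_sum_sq_eq_prod]
  rw [integral_fintype_prod_eq_prod
    (f := fun j x => if j ∈ J then Real.exp (a * x ^ 2) else 1)]
  have h : ∀ j, (∫ x, (if j ∈ J then Real.exp (a * x ^ 2) else 1) ∂(gaussianReal 0 1))
      = if j ∈ J then (1 - 2 * a) ^ (-(1 / 2) : ℝ) else 1 := fun j => by
    split_ifs
    · exact integral_exp_mul_sq_gaussianReal ha
    · simp
  simp_rw [h]
  rw [Finset.prod_ite_mem, Finset.univ_inter, Finset.prod_const, ← Real.rpow_natCast,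
    ← Real.rpow_mul (by linarith)]
  congr 1
  ring

lemma stdGaussian_sum_sq_tail {n : ℕ} (J : Finset (Fin n)) {a : ℝ} (h0 : 0 ≤ a) (ha : a < 1 / 2)
    (s : ℝ) :
    (stdGaussian (EuclideanSpace ℝ (Fin n))).real {x | s ≤ ∑ j ∈ J, x j ^ 2}
      ≤ Real.exp (-a * s) * (1 - 2 * a) ^ (-(J.card / 2) : ℝ) := by
  rw [← integral_exp_mul_sum_sq J ha]
  exact measure_ge_le_exp_mul_mgf s h0 (integrable_exp_mul_sum_sq J ha)

/-- The binomial coefficient is at most n^m/m! = (m^m/m!)(n/m)^m, and m^m/m! is a single term of the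
series for e^m. -/
lemma choose_le_exp {n m : ℕ} (hm : 1 ≤ m) (hmn : m ≤ n) :
    (n.choose m : ℝ) ≤ Real.exp (m * (1 + Real.log ((n : ℝ) / m))) := by
  have hm0 : (0 : ℝ) < m := by exact_mod_cast hm
  have hn0 : (0 : ℝ) < n := by exact_mod_cast hm.trans hmn
  have h1 := Nat.choose_le_pow_div (α := ℝ) m n
  have h2 := Real.pow_div_factorial_le_exp (m : ℝ) hm0.le m
  have h3 : Real.exp (m * Real.log ((n : ℝ) / m)) = ((n : ℝ) / m) ^ m := by
    rw [Real.exp_nat_mul, Real.exp_log (by positivity)]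
  rw [mul_add, mul_one, Real.exp_add, h3]
  refine h1.trans ?_
  calc (n : ℝ) ^ m / (m.factorial : ℝ) = (m : ℝ) ^ m / (m.factorial : ℝ) * ((n : ℝ) / m) ^ m := by
        rw [div_pow]; field_simp
    _ ≤ _ := by gcongr

lemma sum_exp_neg_le_one (n : ℕ) : ∑ m ∈ Finset.Icc 1 n, Real.exp (-(m : ℝ)) ≤ 1 := by
  have h : ∀ n : ℕ, ∑ m ∈ Finset.Icc 1 n, (1 / 2 : ℝ) ^ m = 1 - (1 / 2) ^ n := fun n => by
    induction n with
    | zero => simp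
    | succ n ih => rw [Finset.sum_Icc_succ_top (by omega), ih, pow_succ]; ring
  calc _ ≤ ∑ m ∈ Finset.Icc 1 n, (1 / 2 : ℝ) ^ m := by
        refine Finset.sum_le_sum fun m _ => ?_
        have h1 : Real.exp (-(m : ℝ)) = Real.exp (-1) ^ m := by
          rw [← Real.exp_nat_mul]; ring_nf
        rw [h1]
        gcongr
        rw [Real.exp_neg, one_div]
        have := Real.add_one_le_exp (1 : ℝ)
        gcongr
        linarith
    _ ≤ 1 := by
        rw [h]
        have : (0 : ℝ) ≤ (1 / 2) ^ n := by positivity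
        linarith

/-! ### The typical event -/

/-- All coordinate subsets have controlled sums of squares. -/
def typicalSet (n : ℕ) (t : ℝ) : Set (EuclideanSpace ℝ (Fin n)) :=
  {x | ∀ J : Finset (Fin n), 1 ≤ J.card →
    ∑ j ∈ J, x j ^ 2 ≤ 12 * (J.card * (1 + Real.log ((n : ℝ) / J.card)) + t ^ 2)}

/-- Phrasing the event through coordinate subsets rather than through `decr` makes it an
intersection of closed conditions, so measurability of the rearrangement is never needed. -/
lemma measurableSet_typicalSet (n : ℕ) (t : ℝ) : MeasurableSet (typicalSet n t) := by
  unfold typicalSet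
  refine IsClosed.measurableSet ?_
  simp only [Set.ofPred_forall]
  refine isClosed_iInter fun J => isClosed_iInter fun _ => ?_
  exact isClosed_le (by fun_prop) (by fun_prop)

lemma sumSqBound_of_mem_typicalSet {n : ℕ} {t : ℝ} {x : EuclideanSpace ℝ (Fin n)}
    (hx : x ∈ typicalSet n t) : SumSqBound n 12 t (decr x) := by
  intro m hm hmn
  obtain ⟨J, hJ, hs⟩ := exists_finset_sum_decr_sq hmn x
  rw [hs]
  have := hx J (by omega)
  rwa [hJ] at this

lemma stdGaussian_compl_typicalSet_le (n : ℕ) (t : ℝ) :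
    (stdGaussian (EuclideanSpace ℝ (Fin n))).real (typicalSet n t)ᶜ
      ≤ Real.exp (-t ^ 2 / 2) := by
  set μ := stdGaussian (EuclideanSpace ℝ (Fin n))
  let B : Finset (Fin n) → Set (EuclideanSpace ℝ (Fin n)) := fun J =>
    {x | 12 * (J.card * (1 + Real.log ((n : ℝ) / J.card)) + t ^ 2) ≤ ∑ j ∈ J, x j ^ 2}
  have hsub : (typicalSet n t)ᶜ
      ⊆ ⋃ m ∈ Finset.Icc 1 n, ⋃ J ∈ Finset.powersetCard m (Finset.univ : Finset (Fin n)), B J := by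
    intro x hx
    simp only [typicalSet, Set.mem_compl_iff, Set.mem_ofPred_eq, not_forall, not_le] at hx
    obtain ⟨J, hJ, hlt⟩ := hx
    have hc : J.card ≤ n := by simpa using J.card_le_univ
    simp only [Set.mem_iUnion]
    exact ⟨J.card, Finset.mem_Icc.mpr ⟨hJ, hc⟩, J, by simp [Finset.mem_powersetCard], hlt.le⟩
  have hB : ∀ m ∈ Finset.Icc 1 n, ∀ J ∈ Finset.powersetCard m (Finset.univ : Finset (Fin n)),
      μ.real (B J) ≤ Real.exp (-(m * (1 + Real.log ((n : ℝ) / m)))) * Real.exp (-(m : ℝ))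
        * Real.exp (-t ^ 2 / 2) := by
    intro m hm J hJ
    rw [Finset.mem_Icc] at hm
    rw [Finset.mem_powersetCard] at hJ
    -- With a = 1/4 the moment factor is 2^{m/2} ≤ e^m, and the threshold 12(mL + t²) gives exponent
    -- -3mL - 3t². As L ≥ 1, this leaves -mL to pay for the union over J, -m to sum over m, and
    -- -t²/2.
    have h1 := stdGaussian_sum_sq_tail J (a := 1 / 4) (by norm_num) (by norm_num)
      (12 * (J.card * (1 + Real.log ((n : ℝ) / J.card)) + t ^ 2))
    refine h1.trans ?_
    rw [hJ.2]
    have h2 : (1 - 2 * (1 / 4) : ℝ) ^ (-((m : ℝ) / 2)) ≤ Real.exp m := by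
      have e : (1 - 2 * (1 / 4) : ℝ) = Real.exp (-Real.log 2) := by
        rw [Real.exp_neg, Real.exp_log (by norm_num)]; norm_num
      rw [e, ← Real.exp_mul]
      gcongr
      have := Real.log_two_lt_d9
      have hm0 : (0 : ℝ) ≤ m := by positivity
      nlinarith
    have hL := one_le_one_add_log_div hm.1 hm.2
    set L := 1 + Real.log ((n : ℝ) / m)
    have hm0 : (0 : ℝ) ≤ m := by positivity
    calc _ ≤ Real.exp (-(1 / 4) * (12 * (m * L + t ^ 2))) * Real.exp m := by gcongr
      _ ≤ _ := by
        rw [← Real.exp_add, ← Real.exp_add, ← Real.exp_add]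
        refine Real.exp_le_exp.mpr ?_
        nlinarith [sq_nonneg t, mul_le_mul_of_nonneg_left hL hm0]
  calc μ.real (typicalSet n t)ᶜ
      ≤ μ.real (⋃ m ∈ Finset.Icc 1 n,
          ⋃ J ∈ Finset.powersetCard m (Finset.univ : Finset (Fin n)), B J) :=
        measureReal_mono hsub (measure_ne_top _ _)
    _ ≤ ∑ m ∈ Finset.Icc 1 n,
          μ.real (⋃ J ∈ Finset.powersetCard m (Finset.univ : Finset (Fin n)), B J) :=
        measureReal_biUnion_finset_le _ _
    _ ≤ ∑ m ∈ Finset.Icc 1 n, Real.exp (-(m : ℝ)) * Real.exp (-t ^ 2 / 2) := by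
        refine Finset.sum_le_sum fun m hm => ?_
        refine (measureReal_biUnion_finset_le _ _).trans ?_
        refine (Finset.sum_le_card_nsmul _ _ _ (hB m hm)).trans ?_
        rw [Finset.mem_Icc] at hm
        rw [Finset.card_powersetCard, Finset.card_univ, Fintype.card_fin, nsmul_eq_mul,
          mul_assoc (Real.exp _), ← mul_assoc]
        refine mul_le_of_le_one_left (by positivity) ?_
        rw [Real.exp_neg, ← div_eq_mul_inv, div_le_one (Real.exp_pos _)]
        exact choose_le_exp hm.1 hm.2
    _ ≤ _ := by
        rw [← Finset.sum_mul]
        exact mul_le_of_le_one_left (by positivity) (sum_exp_neg_le_one n)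

lemma stdGaussian_norm_tail {n : ℕ} (hn : 1 ≤ n) {C t : ℝ} (hC : 1 ≤ C) (ht : 0 < t) :
    (stdGaussian (EuclideanSpace ℝ (Fin n))).real {x | C * (n : ℝ) ^ (1 / 2 : ℝ) + t ≤ ‖x‖}
      ≤ Real.exp (-t ^ 2 / 2) := by
  have hn0 : (0 : ℝ) < n := by exact_mod_cast hn
  rw [← Real.sqrt_eq_rpow]
  set w := √(n : ℝ) with hw
  have hw0 : 0 < w := Real.sqrt_pos.mpr hn0
  have hw2 : w ^ 2 = n := Real.sq_sqrt hn0.le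
  set s := C * w + t with hs
  have hs0 : 0 < s := by positivity
  have hws : w < s := by nlinarith
  have hsub : {x : EuclideanSpace ℝ (Fin n) | s ≤ ‖x‖} ⊆ {x | s ^ 2 ≤ ∑ j, x j ^ 2} := by
    intro x hx
    simp only [Set.mem_ofPred_eq] at hx ⊢
    rw [← EuclideanSpace.real_norm_sq_eq]
    exact pow_le_pow_left₀ hs0.le hx 2
  have h1 : w ^ 2 / s ^ 2 ≤ 1 := by
    rw [div_le_one (by positivity)]; exact pow_le_pow_left₀ hw0.le hws.le 2
  have h2 : 0 < w ^ 2 / s ^ 2 := by positivity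
  refine (measureReal_mono hsub).trans ?_
  -- This is the optimal Chernoff parameter for threshold s²: 1 - 2a = n/s², so the moment factor is
  -- (s/√n)^n. Bounding s/√n by an exponential leaves exactly -t²/2 plus non-positive terms.
  refine (stdGaussian_sum_sq_tail Finset.univ (a := (1 - w ^ 2 / s ^ 2) / 2)
    (by linarith) (by linarith) (s ^ 2)).trans ?_
  have e1 : 1 - 2 * ((1 - w ^ 2 / s ^ 2) / 2) = (s / w) ^ (-2 : ℝ) := by
    rw [Real.rpow_neg (by positivity)]
    norm_cast
    rw [div_pow, inv_div]; ring
  have e2 : -((1 - w ^ 2 / s ^ 2) / 2) * s ^ 2 = -(s ^ 2 - w ^ 2) / 2 := by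
    field_simp
  have e3 : (-2 : ℝ) * -(((Finset.univ : Finset (Fin n)).card : ℝ) / 2) = n := by
    simp; ring
  rw [e1, e2, ← Real.rpow_mul (by positivity), e3]
  have h3 : s / w ≤ Real.exp (C - 1 + t / w) := by
    have h4 := Real.add_one_le_exp (C - 1 + t / w)
    have h5 : s / w = C + t / w := by rw [hs]; field_simp
    linarith
  calc _ ≤ Real.exp (-(s ^ 2 - w ^ 2) / 2) * Real.exp (C - 1 + t / w) ^ (n : ℝ) := by gcongr
    _ = Real.exp (-(s ^ 2 - w ^ 2) / 2 + (w ^ 2 * (C - 1) + w * t)) := by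
        rw [← Real.exp_mul, ← Real.exp_add, ← hw2]
        congr 2
        field_simp
    _ ≤ _ := by
        gcongr
        rw [hs]
        nlinarith [mul_nonneg (mul_pos hw0 ht).le (sub_nonneg.mpr hC),
          mul_nonneg (sq_nonneg w) (sq_nonneg (C - 1))]

/-! ### Transfer to a random vector -/

/-- Only the set G must be measurable; the event described by p merely contains its preimage. -/
lemma one_sub_le_measureReal_of_law {n : ℕ} {Ω : Type*} [MeasurableSpace Ω] {P : Measure Ω}
    {X : Ω → EuclideanSpace ℝ (Fin n)}
    (hX : HasLaw X (stdGaussian (EuclideanSpace ℝ (Fin n))) P)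
    {G : Set (EuclideanSpace ℝ (Fin n))} (hG : MeasurableSet G) {ε : ℝ}
    (hε : (stdGaussian (EuclideanSpace ℝ (Fin n))).real Gᶜ ≤ ε)
    {p : EuclideanSpace ℝ (Fin n) → Prop} (hp : ∀ x ∈ G, p x) :
    1 - ε ≤ P.real {ω | p (X ω)} := by
  have : IsProbabilityMeasure P := hX.isProbabilityMeasure
  have h1 : P.real {ω | X ω ∈ G} = (stdGaussian (EuclideanSpace ℝ (Fin n))).real G :=
    hX.measureReal_eq hG
  have h2 := probReal_compl_eq_one_sub (μ := stdGaussian (EuclideanSpace ℝ (Fin n))) hG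
  have h3 : P.real {ω | X ω ∈ G} ≤ P.real {ω | p (X ω)} := measureReal_mono fun ω hω => hp _ hω
  linarith

lemma one_sub_le_measureReal_of_sumSqBound {n : ℕ} {Ω : Type*} [MeasurableSpace Ω] {P : Measure Ω}
    {X : Ω → EuclideanSpace ℝ (Fin n)}
    (hX : HasLaw X (stdGaussian (EuclideanSpace ℝ (Fin n))) P) {t : ℝ}
    {p : EuclideanSpace ℝ (Fin n) → Prop} (hp : ∀ x, SumSqBound n 12 t (decr x) → p x) :
    1 - 1 * Real.exp (-t ^ 2 / 2) ≤ P.real {ω | p (X ω)} := by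
  rw [one_mul]
  exact one_sub_le_measureReal_of_law hX (measurableSet_typicalSet n t)
    (stdGaussian_compl_typicalSet_le n t) fun x hx => hp x (sumSqBound_of_mem_typicalSet hx)

lemma gradFun_nonneg {n : ℕ} (r p : ℝ) (x : EuclideanSpace ℝ (Fin n)) : 0 ≤ gradFun r p x :=
  Finset.sum_nonneg fun i _ =>
    mul_nonneg (Real.rpow_nonneg i.cast_nonneg _) (Real.rpow_nonneg (decr_nonneg x i) _)

lemma rpow_neg_antitone {r : ℝ} (hr : 0 ≤ r) {i j : ℕ} (hi : 1 ≤ i) (hij : i ≤ j) :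
    (j : ℝ) ^ (-(2 * r)) ≤ (i : ℝ) ^ (-(2 * r)) := by
  have hi0 : (0 : ℝ) < i := by exact_mod_cast hi
  have hij' : (i : ℝ) ≤ j := by exact_mod_cast hij
  exact Real.rpow_le_rpow_of_nonpos hi0 hij' (by linarith)

/-! ### The regime `p ≥ 3/2` -/

lemma isNormOn_normI {n : ℕ} (hn : 3 ≤ n) {r p : ℝ} (hr : 0 ≤ r) (hp : 3 / 2 ≤ p) :
    IsNormOn (n := n) (normI r p) :=
  isNormOn_weighted (w := fun i => (i : ℝ) ^ (-(2 * r))) (by omega) le_rfl (by linarith)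
    (fun i j hi hij _ => rpow_neg_antitone hr hi hij)
    (fun i _ _ => Real.rpow_nonneg i.cast_nonneg _) (by simp)

lemma coeffA_nonneg {C : ℝ} (hC : 0 ≤ C) {n : ℕ} (hn : 3 ≤ n) {r p : ℝ} (hp : 1 ≤ p) :
    0 ≤ coeffA C n r p := by
  have hl := one_le_log_of_three_le hn
  unfold coeffA
  split_ifs with h
  · have : 0 ≤ 1 - 2 * r := by linarith
    positivity
  · have : 0 ≤ 2 * r - 1 := by linarith
    positivity

lemma coeffB_nonneg {C : ℝ} (hC : 0 ≤ C) {n : ℕ} (hn : 3 ≤ n) {r p : ℝ} :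
    0 ≤ coeffB C n r p := by
  have hl := one_le_log_of_three_le hn
  unfold coeffB
  split_ifs <;> positivity

lemma boundI_nonneg {C : ℝ} (hC : 0 ≤ C) {n : ℕ} (hn : 3 ≤ n) {r p t : ℝ} (hp : 1 ≤ p)
    (ht : 0 ≤ t) : 0 ≤ boundI C n r p t :=
  add_nonneg (coeffA_nonneg hC hn hp) (mul_nonneg (coeffB_nonneg hC hn) (Real.rpow_nonneg ht _))

lemma sum_le_coeffA {n : ℕ} (hn : 3 ≤ n) {r p : ℝ} (hr : 0 ≤ r) (hp : 1 ≤ p) :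
    24 ^ (p - 1) * ∑ i ∈ Finset.Icc 1 n,
      (i : ℝ) ^ (-(2 * r)) * (1 + Real.log ((n : ℝ) / i)) ^ (p - 1) ≤ coeffA 192 n r p := by
  have hl := one_le_log_of_three_le hn
  have h24 : (24 : ℝ) ^ (p - 1) ≤ 24 ^ p :=
    Real.rpow_le_rpow_of_exponent_le (by norm_num) (by linarith)
  unfold coeffA
  split_ifs with h
  · have hs : 0 ≤ 1 - 2 * r := by linarith
    have := rpow_mul_log_sum_le hs (by linarith) hp hn
    rw [show 1 - 2 * r - 1 = -(2 * r) by ring] at this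
    calc _ ≤ (24 : ℝ) ^ p * (8 ^ p * (n : ℝ) ^ (1 - 2 * r)
          * (p * Real.log n / (p + (1 - 2 * r) * Real.log n)) ^ p) := by
          have h0 : 0 ≤ ∑ i ∈ Finset.Icc 1 n,
              (i : ℝ) ^ (-(2 * r)) * (1 + Real.log ((n : ℝ) / i)) ^ (p - 1) :=
            Finset.sum_nonneg fun i hi => by
              rw [Finset.mem_Icc] at hi
              have := one_le_one_add_log_div hi.1 hi.2
              exact mul_nonneg (Real.rpow_nonneg i.cast_nonneg _) (Real.rpow_nonneg (by linarith) _)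
          exact mul_le_mul h24 this h0 (by positivity)
      _ = _ := by
          rw [Real.div_rpow (by positivity) (by positivity), Real.mul_rpow (by positivity)
            (by positivity), show (192 : ℝ) = 24 * 8 by norm_num,
            Real.mul_rpow (by norm_num) (by norm_num)]
          ring
  · push Not at h
    have := rpow_neg_mul_log_sum_le h hp hn
    have hs : 0 ≤ 2 * r - 1 := by linarith
    calc _ ≤ (24 : ℝ) ^ (p - 1) * (2 ^ p * (Real.log n ^ p / (1 + (2 * r - 1) * Real.log n)
            + Real.log n ^ (p - 1))) := by gcongr
      _ ≤ (24 : ℝ) ^ p * (2 ^ p * (Real.log n ^ p / (1 + (2 * r - 1) * Real.log n)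
            + Real.log n ^ (p - 1))) := by gcongr
      _ = (24 * 2) ^ p * (Real.log n ^ p / (1 + (2 * r - 1) * Real.log n)
            + Real.log n ^ (p - 1)) := by rw [Real.mul_rpow (by norm_num) (by norm_num)]; ring
      _ ≤ 192 ^ p * (Real.log n ^ p / (1 + (2 * r - 1) * Real.log n)
            + Real.log n ^ (p - 1)) := by
          gcongr
          norm_num
      _ = _ := by ring

lemma sum_rpow_le_coeffB {n : ℕ} (hn : 3 ≤ n) {r p : ℝ} (hr : 0 ≤ r) (hp : 1 ≤ p) (hp2 : p < 2) :
    24 ^ (p - 1) * (∑ i ∈ Finset.Icc 1 n, ((i : ℝ) ^ (-(2 * r))) ^ (1 / (2 - p))) ^ (2 - p)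
      ≤ coeffB 192 n r p := by
  have hl := one_le_log_of_three_le hn
  have hθ : 0 < 2 - p := by linarith
  have hn0 : (0 : ℝ) < n := by positivity
  unfold coeffB
  rw [if_pos hp2]
  set δ := 2 - 2 * r - p with hδ
  set a := 1 - 2 * r / (2 - p) with ha
  -- The weights, raised to the dual exponent, form a power sum with parameter a; taking the
  -- (2-p)-th power turns n^a into n^δ. As 2-p ≤ 1, |δ| ≤ |a|, so the logarithmic factor may be
  -- stated with δ.
  have haδ : a * (2 - p) = δ := by rw [ha, hδ]; field_simp; ring
  have ha1 : a ≤ 1 := by rw [ha]; linarith [show 0 ≤ 2 * r / (2 - p) by positivity]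
  have habs : |δ| ≤ |a| := by
    rw [← haδ, abs_mul, abs_of_pos hθ]
    exact mul_le_of_le_one_right (abs_nonneg _) (by linarith)
  have e : ∑ i ∈ Finset.Icc 1 n, ((i : ℝ) ^ (-(2 * r))) ^ (1 / (2 - p))
      = ∑ i ∈ Finset.Icc 1 n, (i : ℝ) ^ (a - 1) := by
    refine Finset.sum_congr rfl fun i _ => ?_
    rw [← Real.rpow_mul i.cast_nonneg]
    congr 1
    rw [ha]; ring
  rw [e]
  have h1 := sum_rpow_sub_one_le_add ha1 hn
  set Λ := Real.log n / (1 + |δ| * Real.log n) with hΛ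
  have hΛ0 : 0 ≤ Λ := by positivity
  have h2 : Real.log n / (1 + |a| * Real.log n) ≤ Λ := by
    rw [hΛ]; gcongr
  have hna := Real.rpow_pos_of_pos hn0 a
  have h3 : ∑ i ∈ Finset.Icc 1 n, (i : ℝ) ^ (a - 1) ≤ 4 * (1 + (1 + (n : ℝ) ^ a) * Λ) :=
    h1.trans (by gcongr)
  have h0 : 0 ≤ ∑ i ∈ Finset.Icc 1 n, (i : ℝ) ^ (a - 1) :=
    Finset.sum_nonneg fun i _ => Real.rpow_nonneg i.cast_nonneg _
  have h24 : (24 : ℝ) ^ (p - 1) ≤ 24 := Real.rpow_le_self_of_one_le (by norm_num) (by linarith)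
  have h4 : (4 : ℝ) ^ (2 - p) ≤ 4 := Real.rpow_le_self_of_one_le (by norm_num) (by linarith)
  have h5 : (1 + (1 + (n : ℝ) ^ a) * Λ) ^ (2 - p) ≤ 1 + Λ ^ (2 - p) * (1 + (n : ℝ) ^ δ) := by
    refine (Real.rpow_add_le_add_rpow (by norm_num) (by positivity) hθ.le (by linarith)).trans ?_
    rw [Real.one_rpow, Real.mul_rpow (by positivity) hΛ0, mul_comm]
    have h6 := Real.rpow_add_le_add_rpow (a := 1) (by norm_num) hna.le hθ.le (by linarith)
    rw [Real.one_rpow, ← Real.rpow_mul hn0.le, haδ] at h6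
    gcongr
  calc _ ≤ 24 * (4 * (1 + (1 + (n : ℝ) ^ a) * Λ)) ^ (2 - p) :=
        mul_le_mul h24 (Real.rpow_le_rpow h0 h3 hθ.le) (Real.rpow_nonneg h0 _) (by norm_num)
    _ = 24 * (4 ^ (2 - p) * (1 + (1 + (n : ℝ) ^ a) * Λ) ^ (2 - p)) := by
        rw [Real.mul_rpow (by norm_num) (by positivity)]
    _ ≤ 24 * (4 * (1 + Λ ^ (2 - p) * (1 + (n : ℝ) ^ δ))) := by gcongr
    _ ≤ _ := by
        have : 0 ≤ 1 + Λ ^ (2 - p) * (1 + (n : ℝ) ^ δ) := by positivity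
        linarith

lemma gradFun_le_boundI {n : ℕ} (hn : 3 ≤ n) {r p t : ℝ} (hr : 0 ≤ r) (hp : 1 ≤ p)
    (ht : 0 ≤ t) {x : EuclideanSpace ℝ (Fin n)} (hx : SumSqBound n 12 t (decr x)) :
    gradFun r p x ≤ boundI 192 n r p t := by
  have hq : 2 * (p - 1) / 2 = p - 1 := by ring
  have hA := sum_le_coeffA hn hr hp
  unfold gradFun boundI
  have ht' := Real.rpow_nonneg ht (2 * (p - 1))
  -- The exponent 2(p-1) crosses 2 at p = 2, where Hölder gives way to the inclusion of ℓ² in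
  -- ℓ^{2(p-1)}. The factor 24 is twice the constant 12 of the typical event.
  rcases lt_or_ge p 2 with h2 | h2
  · have h := hx.sum_rpow_le (by norm_num) ht (decr_nonneg x)
      (fun i j hi hij hj => decr_le_decr x hi hij hj) (subset_refl (Finset.Icc 1 n))
      (w := fun i : ℕ => (i : ℝ) ^ (-(2 * r))) (q := 2 * (p - 1))
      (fun i _ => Real.rpow_nonneg i.cast_nonneg _) (by linarith) (by linarith)
    rw [hq, show 1 - (p - 1) = 2 - p by ring, show (2 * 12 : ℝ) = 24 by norm_num] at h
    have hB := sum_rpow_le_coeffB hn hr hp h2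
    refine h.trans ?_
    rw [mul_add, ← mul_assoc, add_comm]
    gcongr
  · have h := hx.sum_rpow_le_of_two_le (by norm_num) ht (decr_nonneg x)
      (fun i j hi hij hj => decr_le_decr x hi hij hj)
      (w := fun i : ℕ => (i : ℝ) ^ (-(2 * r))) (q := 2 * (p - 1))
      (fun i _ => Real.rpow_nonneg i.cast_nonneg _) (fun i hi => by
        rw [Finset.mem_Icc] at hi
        exact Real.rpow_le_one_of_one_le_of_nonpos (by exact_mod_cast hi.1) (by linarith))
      (by linarith)
    rw [hq, show (2 * 12 : ℝ) = 24 by norm_num] at h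
    have hB : (24 : ℝ) ^ (p - 1) ≤ coeffB 192 n r p := by
      unfold coeffB
      rw [if_neg (by linarith)]
      calc (24 : ℝ) ^ (p - 1) ≤ 24 ^ p :=
            Real.rpow_le_rpow_of_exponent_le (by norm_num) (by linarith)
        _ ≤ 192 ^ p := by gcongr; norm_num
    refine h.trans ?_
    rw [mul_add, add_comm]
    gcongr

lemma regime_large_p {n : ℕ} (hn : 3 ≤ n) {Ω : Type*} [MeasurableSpace Ω] {P : Measure Ω}
    {X : Ω → EuclideanSpace ℝ (Fin n)}
    (hX : HasLaw X (stdGaussian (EuclideanSpace ℝ (Fin n))) P) {r p t : ℝ} (hr : 0 ≤ r)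
    (ht : 0 < t) (hp : 3 / 2 ≤ p) :
    IsNormOn (n := n) (normI r p) ∧
      boundI 192 n r p t = threshI 192 n r p t ^ (2 * (p - 1)) ∧
      TailAndBound P X 1 r p t (normI r p) (threshI 192 n r p t) (boundI 192 n r p t) := by
  have hb := boundI_nonneg (C := 192) (by norm_num) hn (r := r) (p := p) (by linarith) ht.le
  have hq : 0 < 2 * (p - 1) := by linarith
  have heq : boundI 192 n r p t = threshI 192 n r p t ^ (2 * (p - 1)) := by
    rw [threshI, ← Real.rpow_mul hb, one_div_mul_cancel hq.ne', Real.rpow_one]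
  refine ⟨isNormOn_normI hn hr hp, heq, ?_, fun x hx => ?_⟩
  · refine one_sub_le_measureReal_of_sumSqBound hX
      (p := fun x => normI r p x ≤ threshI 192 n r p t) fun x hx => ?_
    exact Real.rpow_le_rpow (gradFun_nonneg r p x)
      (gradFun_le_boundI hn hr (by linarith) ht.le hx) (by positivity)
  · have h1 : (gradFun r p x) ^ (1 / (2 * (p - 1))) ≤ boundI 192 n r p t ^ (1 / (2 * (p - 1))) := hx
    exact (Real.rpow_le_rpow_iff (gradFun_nonneg r p x) hb (by positivity)).mp h1

/-! ### The regime `p < 3/2` -/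

lemma one_le_log_div_add {n i : ℕ} (t : ℝ) (hi : i ∈ upToNDivE n) :
    1 ≤ Real.log ((n : ℝ) / i) + t ^ 2 / i := by
  have := one_le_log_div hi
  have : 0 ≤ t ^ 2 / (i : ℝ) := by positivity
  linarith

lemma summand_antitone {n : ℕ} {r p : ℝ} (hr : 0 ≤ r) (hp : 1 ≤ p)
    (x : EuclideanSpace ℝ (Fin n)) {i j : ℕ} (hi : 1 ≤ i) (hij : i ≤ j) (hj : j ≤ n) :
    (j : ℝ) ^ (-(2 * r)) * decr x j ^ (2 * (p - 1))
      ≤ (i : ℝ) ^ (-(2 * r)) * decr x i ^ (2 * (p - 1)) :=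
  mul_le_mul (rpow_neg_antitone hr hi hij)
    (Real.rpow_le_rpow (decr_nonneg x j) (decr_le_decr x hi hij hj) (by linarith))
    (Real.rpow_nonneg (decr_nonneg x j) _) (Real.rpow_nonneg i.cast_nonneg _)

lemma gradFun_le_six_mul {n : ℕ} (hn : 3 ≤ n) {r p : ℝ} (hr : 0 ≤ r) (hp : 1 ≤ p)
    (x : EuclideanSpace ℝ (Fin n)) :
    gradFun r p x ≤ 6 * ∑ i ∈ upToNDivE n, (i : ℝ) ^ (-(2 * r)) * decr x i ^ (2 * (p - 1)) :=
  sum_le_six_mul_sum_upToNDivE hn (fun _ _ hi hij hj => summand_antitone hr hp x hi hij hj)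
    fun i _ _ => mul_nonneg (Real.rpow_nonneg i.cast_nonneg _)
      (Real.rpow_nonneg (decr_nonneg x i) _)

lemma weightSum_nonneg (n : ℕ) (r p t : ℝ) : 0 ≤ weightSum n r p t :=
  Finset.sum_nonneg fun i hi => by
    have := one_le_log_div_add t hi
    exact mul_nonneg (Real.rpow_nonneg i.cast_nonneg _) (Real.rpow_nonneg (by linarith) _)

lemma normII_nonneg {n : ℕ} (r p t : ℝ) (x : EuclideanSpace ℝ (Fin n)) : 0 ≤ normII r p t x :=
  Finset.sum_nonneg fun i hi => by
    have := one_le_log_div_add t hi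
    exact div_nonneg (mul_nonneg (Real.rpow_nonneg i.cast_nonneg _) (decr_nonneg x i))
      (Real.rpow_nonneg (by linarith) _)

/-- Hölder with θ = 2(p-1) between the terms of the norm and those of `weightSum`: the powers of u =
ln(n/i) + t²/i cancel, and those of i^{-2r} add up to one. -/
lemma gradFun_le_normII {n : ℕ} (hn : 3 ≤ n) {r p t : ℝ} (hr : 0 ≤ r) (hp : 1 ≤ p)
    (hp2 : p < 3 / 2) (x : EuclideanSpace ℝ (Fin n)) :
    gradFun r p x ≤ 6 * (weightSum n r p t ^ (3 - 2 * p) * normII r p t x ^ (2 * (p - 1))) := by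
  refine (gradFun_le_six_mul hn hr hp x).trans ?_
  gcongr
  have h := sum_rpow_mul_rpow_le (upToNDivE n) (θ := 2 * (p - 1))
    (f := fun i => (i : ℝ) ^ (-(2 * r)) * decr x i
      / (Real.log ((n : ℝ) / i) + t ^ 2 / i) ^ ((3 - 2 * p) / 2))
    (g := fun i => (i : ℝ) ^ (-(2 * r)) * (Real.log ((n : ℝ) / i) + t ^ 2 / i) ^ (p - 1))
    (by linarith) (by linarith)
    (fun i hi => by
      have := one_le_log_div_add t hi
      exact div_nonneg (mul_nonneg (Real.rpow_nonneg i.cast_nonneg _) (decr_nonneg x i))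
        (Real.rpow_nonneg (by linarith) _))
    (fun i hi => by
      have := one_le_log_div_add t hi
      exact mul_nonneg (Real.rpow_nonneg i.cast_nonneg _) (Real.rpow_nonneg (by linarith) _))
  rw [show 1 - 2 * (p - 1) = 3 - 2 * p by ring] at h
  rw [mul_comm (weightSum n r p t ^ _)]
  refine le_trans (le_of_eq (Finset.sum_congr rfl fun i hi => ?_)) h
  have hu := one_le_log_div_add t hi
  set u := Real.log ((n : ℝ) / i) + t ^ 2 / i
  have hi0 : (0 : ℝ) < i := by exact_mod_cast (mem_upToNDivE.mp hi).1
  have hw := Real.rpow_pos_of_pos hi0 (-(2 * r))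
  set w := (i : ℝ) ^ (-(2 * r))
  have hd := decr_nonneg x i
  have hu0 : 0 < u := by linarith
  rw [Real.div_rpow (by positivity) (by positivity), Real.mul_rpow hw.le hd,
    Real.mul_rpow hw.le (by positivity), ← Real.rpow_mul hu0.le, ← Real.rpow_mul hu0.le,
    show (3 - 2 * p) / 2 * (2 * (p - 1)) = (p - 1) * (3 - 2 * p) by ring]
  have e : w ^ (2 * (p - 1)) * w ^ (3 - 2 * p) = w := by
    rw [← Real.rpow_add hw, show 2 * (p - 1) + (3 - 2 * p) = 1 by ring, Real.rpow_one]
  have hne : u ^ ((p - 1) * (3 - 2 * p)) ≠ 0 := (Real.rpow_pos_of_pos hu0 _).ne'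
  nth_rw 1 [← e]
  field_simp

/-- The divisor is tuned to the typical size: x_[i] is O(u^{1/2}) with u = ln(n/i) + t²/i, and
u^{1/2}/u^{(3-2p)/2} = u^{p-1}. The comparison therefore holds term by term. -/
lemma normII_le_threshII {n : ℕ} {r p t : ℝ}
    {x : EuclideanSpace ℝ (Fin n)} (hx : SumSqBound n 12 t (decr x)) :
    normII r p t x ≤ threshII 192 n r p t := by
  unfold normII threshII weightSum
  rw [Finset.mul_sum]
  refine Finset.sum_le_sum fun i hi => ?_
  have hu := one_le_log_div_add t hi
  have hi' := Finset.mem_Icc.mp (upToNDivE_subset n hi)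
  have h1 := hx.sq_le (decr_nonneg x) (fun i j hi hij hj => decr_le_decr x hi hij hj) hi'.1 hi'.2
  have hL := one_le_log_div hi
  have hti : 0 ≤ t ^ 2 / (i : ℝ) := by positivity
  set u := Real.log ((n : ℝ) / i) + t ^ 2 / i with hudef
  have hu0 : 0 < u := by linarith
  have h2 : decr x i ≤ 192 * u ^ (1 / 2 : ℝ) := by
    rw [← Real.sqrt_eq_rpow]
    have h3 : decr x i ^ 2 ≤ 24 * u := by linarith
    have h4 : (192 * √u) ^ 2 = 192 ^ 2 * u := by rw [mul_pow, Real.sq_sqrt hu0.le]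
    exact le_of_sq_le_sq (by rw [h4]; linarith) (by positivity)
  have e : u ^ (p - 1) = u ^ (1 / 2 : ℝ) / u ^ ((3 - 2 * p) / 2) := by
    rw [← Real.rpow_sub hu0]; congr 1; ring
  calc _ = (i : ℝ) ^ (-(2 * r)) / u ^ ((3 - 2 * p) / 2) * decr x i := by ring
    _ ≤ (i : ℝ) ^ (-(2 * r)) / u ^ ((3 - 2 * p) / 2) * (192 * u ^ (1 / 2 : ℝ)) := by gcongr
    _ = _ := by rw [e]; ring

lemma weightSum_le {n : ℕ} (hn : 3 ≤ n) {r p t : ℝ} (hr : 0 ≤ r) (hp : 1 ≤ p)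
    (hp2 : p < 3 / 2) (ht : 0 < t) : 19200 * weightSum n r p t ≤ explicitII 10000000 n r p t := by
  have hl := one_le_log_of_three_le hn
  have hn0 : (0 : ℝ) < n := by positivity
  have h1 : weightSum n r p t
      ≤ ∑ i ∈ Finset.Icc 1 n, (i : ℝ) ^ (-(2 * r)) * (1 + Real.log ((n : ℝ) / i)) ^ (p - 1)
        + (∑ i ∈ Finset.Icc 1 n, (i : ℝ) ^ ((2 - 2 * r - p) - 1)) * t ^ (2 * (p - 1)) := by
    rw [Finset.sum_mul, ← Finset.sum_add_distrib]
    unfold weightSum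
    refine (Finset.sum_le_sum fun i hi => ?_).trans
      (Finset.sum_le_sum_of_subset_of_nonneg (upToNDivE_subset n) fun i hi _ => ?_)
    · have hL := one_le_log_div hi
      have hi0 : (0 : ℝ) < i := by exact_mod_cast (mem_upToNDivE.mp hi).1
      -- Since 0 ≤ p-1 ≤ 1, the power is subadditive, which separates the typical part from the t
      -- part.
      have h3 := Real.rpow_add_le_add_rpow (a := Real.log ((n : ℝ) / i)) (b := t ^ 2 / i)
        (by linarith) (by positivity) (show 0 ≤ p - 1 by linarith) (by linarith)
      have h4 : (t ^ 2 / i) ^ (p - 1) = (i : ℝ) ^ (-(p - 1)) * t ^ (2 * (p - 1)) := by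
        rw [Real.div_rpow (by positivity) hi0.le, ← Real.rpow_natCast t 2, ← Real.rpow_mul ht.le,
          Real.rpow_neg hi0.le]
        push_cast
        field_simp
      have h5 : Real.log ((n : ℝ) / i) ^ (p - 1) ≤ (1 + Real.log ((n : ℝ) / i)) ^ (p - 1) :=
        Real.rpow_le_rpow (by linarith) (by linarith) (by linarith)
      have h6 : (i : ℝ) ^ ((2 - 2 * r - p) - 1) = (i : ℝ) ^ (-(2 * r)) * (i : ℝ) ^ (-(p - 1)) := by
        rw [← Real.rpow_add hi0]; congr 1; ring
      rw [h6, mul_assoc, ← h4, ← mul_add]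
      gcongr
      linarith
    · rw [Finset.mem_Icc] at hi
      have := one_le_one_add_log_div hi.1 hi.2
      have : 0 ≤ 1 + Real.log ((n : ℝ) / i) := by linarith
      positivity
  have h2 := sum_rpow_sub_one_le_add (a := 2 - 2 * r - p) (by linarith) hn
  have htq := Real.rpow_pos_of_pos ht (2 * (p - 1))
  have h2p : (2 : ℝ) ^ p ≤ 4 := by
    calc (2 : ℝ) ^ p ≤ 2 ^ (2 : ℝ) := Real.rpow_le_rpow_of_exponent_le (by norm_num) (by linarith)
      _ = 4 := by norm_num
  have h12p : (12 : ℝ) ^ p ≤ 144 := by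
    calc (12 : ℝ) ^ p ≤ 12 ^ (2 : ℝ) :=
          Real.rpow_le_rpow_of_exponent_le (by norm_num) (by linarith)
      _ = 144 := by norm_num
  have hnd := Real.rpow_pos_of_pos hn0 (2 - 2 * r - p)
  have h7 : 19200 * ((∑ i ∈ Finset.Icc 1 n, (i : ℝ) ^ ((2 - 2 * r - p) - 1)) * t ^ (2 * (p - 1)))
      ≤ 10000000 * (1 + (1 + (n : ℝ) ^ (2 - 2 * r - p)) / (1 + |2 - 2 * r - p| * Real.log n)
        * Real.log n) * t ^ (2 * (p - 1)) := by
    rw [← mul_assoc]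
    refine mul_le_mul_of_nonneg_right ?_ htq.le
    have e : (1 + (n : ℝ) ^ (2 - 2 * r - p)) / (1 + |2 - 2 * r - p| * Real.log n) * Real.log n
        = (1 + (n : ℝ) ^ (2 - 2 * r - p)) * (Real.log n / (1 + |2 - 2 * r - p| * Real.log n)) := by
      ring
    rw [e]
    have : 0 ≤ (1 + (n : ℝ) ^ (2 - 2 * r - p))
        * (Real.log n / (1 + |2 - 2 * r - p| * Real.log n)) := by positivity
    linarith
  have h8 : 19200 * ∑ i ∈ Finset.Icc 1 n,
      (i : ℝ) ^ (-(2 * r)) * (1 + Real.log ((n : ℝ) / i)) ^ (p - 1)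
      ≤ if r ≤ 1 / 2 then
        10000000 * (n : ℝ) ^ (1 - 2 * r) * Real.log n ^ p / (1 + (1 - 2 * r) * Real.log n) ^ p
      else 10000000 * (Real.log n ^ p / (1 + (2 * r - 1) * Real.log n)
        + Real.log n ^ (p - 1)) := by
    split_ifs with h
    · have hs : 0 ≤ 1 - 2 * r := by linarith
      have hd : 0 < 1 + (1 - 2 * r) * Real.log n := by positivity
      have h9 := rpow_mul_log_sum_le hs (by linarith) hp hn
      rw [show 1 - 2 * r - 1 = -(2 * r) by ring] at h9
      have h10 : p * Real.log n / (p + (1 - 2 * r) * Real.log n)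
          ≤ 3 / 2 * (Real.log n / (1 + (1 - 2 * r) * Real.log n)) := by
        rw [← mul_div_assoc]
        gcongr
      calc _ ≤ 19200 * (8 ^ p * (n : ℝ) ^ (1 - 2 * r)
            * (3 / 2 * (Real.log n / (1 + (1 - 2 * r) * Real.log n))) ^ p) := by
            refine mul_le_mul_of_nonneg_left (h9.trans ?_) (by norm_num)
            gcongr
        _ = 19200 * 12 ^ p * ((n : ℝ) ^ (1 - 2 * r)
            * (Real.log n ^ p / (1 + (1 - 2 * r) * Real.log n) ^ p)) := by
            rw [show (12 : ℝ) = 8 * (3 / 2) by norm_num, Real.mul_rpow (by norm_num) (div_nonneg (by linarith) hd.le),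
              Real.mul_rpow (by norm_num) (by norm_num),
              Real.div_rpow (by linarith) hd.le]
            ring
        _ ≤ 10000000 * ((n : ℝ) ^ (1 - 2 * r)
            * (Real.log n ^ p / (1 + (1 - 2 * r) * Real.log n) ^ p)) := by
            gcongr
            linarith
        _ = _ := by ring
    · push Not at h
      have h9 := rpow_neg_mul_log_sum_le h hp hn
      have hs : 0 ≤ 2 * r - 1 := by linarith
      have : 0 ≤ Real.log n ^ p / (1 + (2 * r - 1) * Real.log n) + Real.log n ^ (p - 1) := by
        positivity
      nlinarith [mul_le_mul_of_nonneg_right h2p this]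
  unfold explicitII
  linarith

/-- The function z ln(n/z) increases up to z = n/e, which is the reason for truncating the sums
there. -/
lemma mul_log_div_mono {n i j : ℕ} (hi : 1 ≤ i) (hij : i ≤ j) (hj : j ∈ upToNDivE n) :
    (i : ℝ) * Real.log ((n : ℝ) / i) ≤ j * Real.log ((n : ℝ) / j) := by
  have hi0 : (0 : ℝ) < i := by exact_mod_cast hi
  have hj0 : (0 : ℝ) < j := by exact_mod_cast hi.trans hij
  have hij' : (i : ℝ) ≤ j := by exact_mod_cast hij
  have hL := one_le_log_div hj
  have hjn := (Finset.mem_Icc.mp (upToNDivE_subset n hj))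
  have hn0 : (0 : ℝ) < n := by exact_mod_cast hjn.1.trans hjn.2
  have e : Real.log ((n : ℝ) / i) = Real.log ((n : ℝ) / j) + Real.log ((j : ℝ) / i) := by
    rw [← Real.log_mul (by positivity) (by positivity)]
    congr 1; field_simp
  have h1 : Real.log ((j : ℝ) / i) ≤ (j : ℝ) / i - 1 := Real.log_le_sub_one_of_pos (by positivity)
  have h2 : (i : ℝ) * Real.log ((j : ℝ) / i) ≤ j - i := by
    calc _ ≤ (i : ℝ) * ((j : ℝ) / i - 1) := by gcongr
      _ = _ := by field_simp
  rw [e]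
  nlinarith [mul_le_mul_of_nonneg_left hL (sub_nonneg.mpr hij')]

lemma mem_upToNDivE_of_le_floor {n i : ℕ} (hi : 1 ≤ i) (h : i ≤ ⌊(n : ℝ) / Real.exp 1⌋₊) :
    i ∈ upToNDivE n := Finset.mem_Icc.mpr ⟨hi, h⟩

lemma isNormOn_normII {n : ℕ} (hn : 3 ≤ n) {r p t : ℝ}
    (hp2 : p < 3 / 2) (hrp : 3 / 2 - 2 * r ≤ p) : IsNormOn (n := n) (normII r p t) := by
  have hm := one_le_floor_div_exp hn
  set κ := (3 - 2 * p) / 2 with hκ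
  have h := isNormOn_weighted_one hm (floor_div_exp_le n)
    (w := fun i => (i : ℝ) ^ (-(2 * r)) / (Real.log ((n : ℝ) / i) + t ^ 2 / i) ^ κ) ?_ ?_ ?_
  · have e : (normII (n := n) r p t) = fun x => ∑ i ∈ Finset.Icc 1 ⌊(n : ℝ) / Real.exp 1⌋₊,
        (i : ℝ) ^ (-(2 * r)) / (Real.log ((n : ℝ) / i) + t ^ 2 / i) ^ κ * decr x i := by
      funext x
      unfold normII upToNDivE
      refine Finset.sum_congr rfl fun i _ => ?_
      ring
    rw [e]
    exact h
  · intro i j hi hij hj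
    have hjm := mem_upToNDivE_of_le_floor (hi.trans hij) hj
    have him := mem_upToNDivE_of_le_floor hi (hij.trans hj)
    -- Moving k^κ inside the logarithmic factor leaves k^{-(2r-κ)} times a negative power of the
    -- increasing quantity k ln(n/k) + t². The first factor is non-increasing exactly when 2r ≥ κ,
    -- that is p ≥ 3/2 - 2r.
    have e : ∀ k ∈ upToNDivE n, (k : ℝ) ^ (-(2 * r))
        / (Real.log ((n : ℝ) / k) + t ^ 2 / k) ^ κ
        = (k : ℝ) ^ (-(2 * r - κ)) * (k * Real.log ((n : ℝ) / k) + t ^ 2) ^ (-κ) := fun k hk => by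
      have hk0 : (0 : ℝ) < k := by exact_mod_cast (mem_upToNDivE.mp hk).1
      have hu := one_le_log_div_add t hk
      have e1 : k * Real.log ((n : ℝ) / k) + t ^ 2
          = k * (Real.log ((n : ℝ) / k) + t ^ 2 / k) := by field_simp
      rw [e1, Real.mul_rpow hk0.le (by linarith), ← mul_assoc, ← Real.rpow_add hk0,
        Real.rpow_neg (x := Real.log ((n : ℝ) / k) + t ^ 2 / k) (by linarith), div_eq_mul_inv]
      congr 2
      ring
    rw [e i him, e j hjm]
    have hi0 : (0 : ℝ) < i := by exact_mod_cast hi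
    have hij' : (i : ℝ) ≤ j := by exact_mod_cast hij
    have hli := one_le_log_div him
    have hpos : 0 < (i : ℝ) * Real.log ((n : ℝ) / i) + t ^ 2 := by
      have : 0 < Real.log ((n : ℝ) / i) := by linarith
      positivity
    have hmono := mul_log_div_mono hi hij hjm
    refine mul_le_mul ?_ ?_ ?_ ?_
    · exact Real.rpow_le_rpow_of_nonpos hi0 hij' (by linarith)
    · exact Real.rpow_le_rpow_of_nonpos hpos (by linarith) (by linarith)
    · exact Real.rpow_nonneg (by linarith) _
    · positivity
  · intro i hi him
    have hu := one_le_log_div_add t (mem_upToNDivE_of_le_floor hi him)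
    exact div_nonneg (Real.rpow_nonneg i.cast_nonneg _) (Real.rpow_nonneg (by linarith) _)
  · have hu := one_le_log_div_add t (mem_upToNDivE_of_le_floor le_rfl hm)
    exact div_pos (by simp) (Real.rpow_pos_of_pos (by linarith) _)

lemma regime_small_p {n : ℕ} (hn : 3 ≤ n) {Ω : Type*} [MeasurableSpace Ω] {P : Measure Ω}
    {X : Ω → EuclideanSpace ℝ (Fin n)}
    (hX : HasLaw X (stdGaussian (EuclideanSpace ℝ (Fin n))) P) {r p t : ℝ} (hr : 0 ≤ r)
    (hp : 1 ≤ p) (ht : 0 < t) (hp2 : p < 3 / 2) :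
    (∀ x : EuclideanSpace ℝ (Fin n),
      gradFun r p x ≤ 100 * weightSum n r p t ^ (3 - 2 * p) * normII r p t x ^ (2 * (p - 1))) ∧
    TailAndBound P X 1 r p t (normII r p t) (threshII 192 n r p t) (100 * threshII 192 n r p t) ∧
    100 * threshII 192 n r p t ≤ explicitII 10000000 n r p t ∧
    (3 / 2 - 2 * r ≤ p → IsNormOn (n := n) (normII r p t)) := by
  have hgrad : ∀ x : EuclideanSpace ℝ (Fin n), gradFun r p x
      ≤ 100 * weightSum n r p t ^ (3 - 2 * p) * normII r p t x ^ (2 * (p - 1)) := fun x => by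
    refine (gradFun_le_normII hn hr hp hp2 x (t := t)).trans ?_
    have h1 := Real.rpow_nonneg (weightSum_nonneg n r p t) (3 - 2 * p)
    have h2 := Real.rpow_nonneg (normII_nonneg r p t x) (2 * (p - 1))
    rw [mul_assoc]
    gcongr
    norm_num
  refine ⟨hgrad, ⟨?_, fun x hx => (hgrad x).trans ?_⟩, ?_, isNormOn_normII hn hp2⟩
  · exact one_sub_le_measureReal_of_sumSqBound hX
      (p := fun x => normII r p t x ≤ threshII 192 n r p t) fun x hx => normII_le_threshII hx
  · have hT := weightSum_nonneg n r p t
    unfold threshII at hx ⊢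
    have h1 : normII r p t x ^ (2 * (p - 1)) ≤ 192 * weightSum n r p t ^ (2 * (p - 1)) := by
      calc _ ≤ (192 * weightSum n r p t) ^ (2 * (p - 1)) :=
            Real.rpow_le_rpow (normII_nonneg r p t x) hx (by linarith)
        _ = 192 ^ (2 * (p - 1)) * weightSum n r p t ^ (2 * (p - 1)) := by
            rw [Real.mul_rpow (by norm_num) hT]
        _ ≤ _ := by
            gcongr
            exact Real.rpow_le_self_of_one_le (by norm_num) (by linarith)
    -- The two exponents add to 1, so R is linear in T. The form of `rpow_add'` used here also
    -- covers T = 0.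
    have e : weightSum n r p t ^ (3 - 2 * p) * weightSum n r p t ^ (2 * (p - 1))
        = weightSum n r p t := by
      rw [← Real.rpow_add' hT (by norm_num; ring_nf; norm_num),
        show 3 - 2 * p + 2 * (p - 1) = 1 by ring, Real.rpow_one]
    calc _ ≤ 100 * weightSum n r p t ^ (3 - 2 * p)
          * (192 * weightSum n r p t ^ (2 * (p - 1))) := by gcongr
      _ = 100 * (192 * (weightSum n r p t ^ (3 - 2 * p)
          * weightSum n r p t ^ (2 * (p - 1)))) := by ring
      _ = _ := by rw [e]
  · refine le_trans (le_of_eq ?_) (weightSum_le hn hr hp hp2 ht)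
    unfold threshII
    ring

/-! ### The regime `p < 3/2 - 2r` -/

lemma rpow_half_le_mul_rpow_half {a b c : ℝ} (hc : 0 ≤ c) (hb : b ≤ c ^ 2 * a) :
    b ^ (1 / 2 : ℝ) ≤ c * a ^ (1 / 2 : ℝ) := by
  rw [← Real.sqrt_eq_rpow, ← Real.sqrt_eq_rpow]
  calc √b ≤ √(c ^ 2 * a) := Real.sqrt_le_sqrt hb
    _ = c * √a := by rw [Real.sqrt_mul (by positivity), Real.sqrt_sq hc]

lemma rpow_half_twenty_four_le : (24 : ℝ) ^ (1 / 2 : ℝ) ≤ 5 := by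
  rw [← Real.sqrt_eq_rpow, Real.sqrt_le_left (by norm_num)]
  norm_num

/-- Deviation bound for a nonnegative weighted sum of the rearrangement. -/
lemma SumSqBound.sum_mul_le {n : ℕ} {t : ℝ} {y : ℕ → ℝ} (ht : 0 ≤ t)
    (h : SumSqBound n 12 t y)
    (h0 : ∀ i, 0 ≤ y i) (hy : ∀ i j, 1 ≤ i → i ≤ j → j ≤ n → y j ≤ y i)
    {s : Finset ℕ} (hs : s ⊆ Finset.Icc 1 n) {w : ℕ → ℝ} (hw : ∀ i ∈ s, 0 ≤ w i) :
    ∑ i ∈ s, w i * y i ≤ 5 * ((∑ i ∈ s, w i ^ 2) ^ (1 / 2 : ℝ) * t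
        + ∑ i ∈ s, w i * (1 + Real.log ((n : ℝ) / i)) ^ (1 / 2 : ℝ)) := by
  have := h.sum_rpow_le (by norm_num) ht h0 hy hs hw (q := 1) (by norm_num) (by norm_num)
  norm_num at this
  have h24 := rpow_half_twenty_four_le
  rw [one_div] at h24 ⊢
  norm_num at h24 ⊢
  refine this.trans (mul_le_mul_of_nonneg_right h24 ?_)
  refine add_nonneg (mul_nonneg (Real.rpow_nonneg (Finset.sum_nonneg fun i _ => sq_nonneg _) _) ht)
    (Finset.sum_nonneg fun i hi => mul_nonneg (hw i hi) (Real.rpow_nonneg ?_ _))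
  have hi' := Finset.mem_Icc.mp (hs hi)
  linarith [one_le_one_add_log_div hi'.1 hi'.2]

lemma isNormOn_normIII {n : ℕ} (hn : 3 ≤ n) {r : ℝ} (hr : 0 ≤ r) :
    IsNormOn (n := n) (normIII r) :=
  isNormOn_weighted_one (w := fun i => (i : ℝ) ^ (-(2 * r))) (by omega) le_rfl
    (fun i j hi hij _ => rpow_neg_antitone hr hi hij)
    (fun i _ _ => Real.rpow_nonneg i.cast_nonneg _) (by simp)

lemma normIII_nonneg {n : ℕ} (r : ℝ) (x : EuclideanSpace ℝ (Fin n)) : 0 ≤ normIII r x :=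
  Finset.sum_nonneg fun i _ => mul_nonneg (Real.rpow_nonneg i.cast_nonneg _) (decr_nonneg x i)

lemma gradFun_le_normIII {n : ℕ} {r p : ℝ} (hr : 0 ≤ r) (hr4 : r < 1 / 4)
    (hp : 1 ≤ p) (hp2 : p < 3 / 2) (x : EuclideanSpace ℝ (Fin n)) :
    gradFun r p x ≤ 2 * (n : ℝ) ^ ((1 - 2 * r) * (3 - 2 * p)) * normIII r x ^ (2 * (p - 1)) := by
  have h := sum_rpow_mul_rpow_le (Finset.Icc 1 n) (θ := 2 * (p - 1))
    (f := fun i => (i : ℝ) ^ (-(2 * r)) * decr x i) (g := fun i => (i : ℝ) ^ (-(2 * r)))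
    (by linarith) (by linarith)
    (fun i _ => mul_nonneg (Real.rpow_nonneg i.cast_nonneg _) (decr_nonneg x i))
    (fun i _ => Real.rpow_nonneg i.cast_nonneg _)
  rw [show 1 - 2 * (p - 1) = 3 - 2 * p by ring] at h
  have hn0 : (0 : ℝ) ≤ n := n.cast_nonneg
  have h1 : ∑ i ∈ Finset.Icc 1 n, (i : ℝ) ^ (-(2 * r)) ≤ 2 * (n : ℝ) ^ (1 - 2 * r) := by
    have h2 := sum_rpow_sub_one_le (σ := 1 - 2 * r) (by linarith) (by linarith) n
    rw [show 1 - 2 * r - 1 = -(2 * r) by ring] at h2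
    refine h2.trans ?_
    rw [div_le_iff₀ (by linarith)]
    nlinarith [Real.rpow_nonneg hn0 (1 - 2 * r)]
  have h0 : 0 ≤ ∑ i ∈ Finset.Icc 1 n, (i : ℝ) ^ (-(2 * r)) :=
    Finset.sum_nonneg fun i _ => Real.rpow_nonneg i.cast_nonneg _
  have hN := normIII_nonneg r x
  calc gradFun r p x
      = ∑ i ∈ Finset.Icc 1 n, ((i : ℝ) ^ (-(2 * r)) * decr x i) ^ (2 * (p - 1))
          * ((i : ℝ) ^ (-(2 * r))) ^ (3 - 2 * p) := by
        unfold gradFun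
        refine Finset.sum_congr rfl fun i hi => ?_
        have hi0 : (0 : ℝ) < i := by exact_mod_cast (Finset.mem_Icc.mp hi).1
        have hw := Real.rpow_pos_of_pos hi0 (-(2 * r))
        set w := (i : ℝ) ^ (-(2 * r))
        rw [Real.mul_rpow hw.le (decr_nonneg x i)]
        have e : w ^ (2 * (p - 1)) * w ^ (3 - 2 * p) = w := by
          rw [← Real.rpow_add hw, show 2 * (p - 1) + (3 - 2 * p) = 1 by ring, Real.rpow_one]
        nth_rw 1 [← e]
        ring
    _ ≤ normIII r x ^ (2 * (p - 1)) * (∑ i ∈ Finset.Icc 1 n, (i : ℝ) ^ (-(2 * r))) ^ (3 - 2 * p) := h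
    _ ≤ normIII r x ^ (2 * (p - 1)) * (2 * (n : ℝ) ^ (1 - 2 * r)) ^ (3 - 2 * p) := by
        gcongr
        linarith
    _ = normIII r x ^ (2 * (p - 1))
          * (2 ^ (3 - 2 * p) * (n : ℝ) ^ ((1 - 2 * r) * (3 - 2 * p))) := by
        rw [Real.mul_rpow (by norm_num) (by positivity), ← Real.rpow_mul hn0]
    _ ≤ normIII r x ^ (2 * (p - 1)) * (2 * (n : ℝ) ^ ((1 - 2 * r) * (3 - 2 * p))) := by
        have : (2 : ℝ) ^ (3 - 2 * p) ≤ 2 := Real.rpow_le_self_of_one_le (by norm_num) (by linarith)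
        gcongr
    _ = _ := by ring

lemma normIII_le_threshIII {n : ℕ} (hn : 3 ≤ n) {r t : ℝ} (hr : 0 ≤ r) (hr4 : r < 1 / 4)
    (ht : 0 < t) {x : EuclideanSpace ℝ (Fin n)} (hx : SumSqBound n 12 t (decr x)) :
    normIII r x ≤ threshIII 192 n r t := by
  have hl := one_le_log_of_three_le hn
  have hn0 : (0 : ℝ) < n := by positivity
  have h := hx.sum_mul_le ht.le (decr_nonneg x) (fun i j hi hij hj => decr_le_decr x hi hij hj)
    (subset_refl (Finset.Icc 1 n)) (w := fun i : ℕ => (i : ℝ) ^ (-(2 * r)))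
    (fun i _ => Real.rpow_nonneg i.cast_nonneg _)
  have ha : 0 ≤ 1 - 4 * r := by linarith
  have hd : 0 < 1 + (1 - 4 * r) * Real.log n := by positivity
  set Λ := Real.log n / (1 + (1 - 4 * r) * Real.log n) with hΛ
  have hΛ0 : 0 ≤ Λ := div_nonneg (by linarith) hd.le
  have h1 : (∑ i ∈ Finset.Icc 1 n, ((i : ℝ) ^ (-(2 * r))) ^ 2) ^ (1 / 2 : ℝ)
      ≤ 2 * ((n : ℝ) ^ ((1 - 4 * r) / 2) * Λ ^ (1 / 2 : ℝ)) := by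
    have e : ∑ i ∈ Finset.Icc 1 n, ((i : ℝ) ^ (-(2 * r))) ^ 2
        = ∑ i ∈ Finset.Icc 1 n, (i : ℝ) ^ ((1 - 4 * r) - 1) := by
      refine Finset.sum_congr rfl fun i _ => ?_
      rw [← Real.rpow_natCast, ← Real.rpow_mul i.cast_nonneg]
      congr 1; push_cast; ring
    rw [e]
    have h2 := sum_rpow_sub_one_le_mul_log ha (by linarith) hn
    have h3 := rpow_half_le_mul_rpow_half (a := (n : ℝ) ^ (1 - 4 * r) * Λ) (c := 2)
      (by norm_num) (h2.trans (le_of_eq (by ring)))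
    refine h3.trans (le_of_eq ?_)
    rw [Real.mul_rpow (by positivity) hΛ0, ← Real.rpow_mul hn0.le]
    congr 3
    ring
  have h4 : ∑ i ∈ Finset.Icc 1 n,
      (i : ℝ) ^ (-(2 * r)) * (1 + Real.log ((n : ℝ) / i)) ^ (1 / 2 : ℝ)
      ≤ 30 * (n : ℝ) ^ (1 - 2 * r) := by
    -- The auxiliary exponent 3/2 yields the power 1/2 of the logarithm. Since r < 1/4, s = 1-2r
    -- exceeds 1/2 and the constant stays bounded: 2·6^{3/2} ≤ 30.
    have h5 := rpow_mul_log_sum_le_div (s := 1 - 2 * r) (p := 3 / 2) (by linarith) (by linarith)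
      (by norm_num) (n := n)
    rw [show 1 - 2 * r - 1 = -(2 * r) by ring, show (3 / 2 - 1 : ℝ) = 1 / 2 by norm_num] at h5
    refine h5.trans ?_
    have h6 : (2 * (3 / 2) / (1 - 2 * r)) ^ (3 / 2 : ℝ) ≤ 15 := by
      have h7 : 2 * (3 / 2) / (1 - 2 * r) ≤ 6 := by
        rw [div_le_iff₀ (by linarith)]; linarith
      have h8 : 0 ≤ 2 * (3 / 2) / (1 - 2 * r) := div_nonneg (by norm_num) (by linarith)
      calc _ ≤ (6 : ℝ) ^ (3 / 2 : ℝ) := Real.rpow_le_rpow h8 h7 (by norm_num)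
        _ = √(6 ^ 3) := by
            rw [Real.sqrt_eq_rpow, ← Real.rpow_natCast, ← Real.rpow_mul (by norm_num)]
            norm_num
        _ ≤ 15 := by
            rw [Real.sqrt_le_left (by norm_num)]; norm_num
    have := Real.rpow_nonneg hn0.le (1 - 2 * r)
    nlinarith
  unfold normIII threshIII
  refine h.trans ?_
  have h9 := mul_le_mul_of_nonneg_right h1 ht.le
  have h10 : 0 ≤ (n : ℝ) ^ ((1 - 4 * r) / 2) * Λ ^ (1 / 2 : ℝ) * t := by positivity
  have h11 := Real.rpow_nonneg hn0.le (1 - 2 * r)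
  linarith

lemma regime_small_r {n : ℕ} (hn : 3 ≤ n) {Ω : Type*} [MeasurableSpace Ω] {P : Measure Ω}
    {X : Ω → EuclideanSpace ℝ (Fin n)}
    (hX : HasLaw X (stdGaussian (EuclideanSpace ℝ (Fin n))) P) {r p t : ℝ} (hr : 0 ≤ r)
    (hp : 1 ≤ p) (ht : 0 < t) (hrp : p < 3 / 2 - 2 * r) :
    r < 1 / 4 ∧ p < 3 / 2 ∧
    IsNormOn (n := n) (normIII r) ∧
    (∀ x : EuclideanSpace ℝ (Fin n), gradFun r p x
      ≤ 100 * (n : ℝ) ^ ((1 - 2 * r) * (3 - 2 * p)) * normIII r x ^ (2 * (p - 1))) ∧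
    TailAndBound P X 1 r p t (normIII r) (threshIII 192 n r t)
      (100 * (n : ℝ) ^ ((1 - 2 * r) * (3 - 2 * p)) * threshIII 192 n r t ^ (2 * (p - 1))) ∧
    100 * (n : ℝ) ^ ((1 - 2 * r) * (3 - 2 * p)) * threshIII 192 n r t ^ (2 * (p - 1))
      ≤ explicitIII 10000000 n r p t := by
  have hr4 : r < 1 / 4 := by linarith
  have hp2 : p < 3 / 2 := by linarith
  have hl := one_le_log_of_three_le hn
  have hn0 : (0 : ℝ) < n := by positivity
  have hgrad : ∀ x : EuclideanSpace ℝ (Fin n), gradFun r p x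
      ≤ 100 * (n : ℝ) ^ ((1 - 2 * r) * (3 - 2 * p)) * normIII r x ^ (2 * (p - 1)) := fun x => by
    refine (gradFun_le_normIII hr hr4 hp hp2 x).trans ?_
    have h2 := Real.rpow_nonneg (normIII_nonneg r x) (2 * (p - 1))
    gcongr
    norm_num
  refine ⟨hr4, hp2, isNormOn_normIII hn hr, hgrad, ⟨?_, fun x hx => (hgrad x).trans ?_⟩, ?_⟩
  · exact one_sub_le_measureReal_of_sumSqBound hX
      (p := fun x => normIII r x ≤ threshIII 192 n r t)
      fun x hx => normIII_le_threshIII hn hr hr4 ht hx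
  · have h1 : normIII r x ^ (2 * (p - 1)) ≤ threshIII 192 n r t ^ (2 * (p - 1)) :=
      Real.rpow_le_rpow (normIII_nonneg r x) hx (by linarith)
    gcongr
  · have ha : 0 ≤ 1 - 4 * r := by linarith
    unfold threshIII explicitIII
    set Λ := Real.log n / (1 + (1 - 4 * r) * Real.log n) with hΛ
    have hΛ0 : 0 ≤ Λ := by positivity
    have hq : 0 ≤ 2 * (p - 1) := by linarith
    have h192 : (192 : ℝ) ^ (2 * (p - 1)) ≤ 192 :=
      Real.rpow_le_self_of_one_le (by norm_num) (by linarith)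
    have h1 := Real.rpow_add_le_add_rpow (a := 192 * (n : ℝ) ^ (1 - 2 * r))
      (b := 192 * (n : ℝ) ^ ((1 - 4 * r) / 2) * Λ ^ (1 / 2 : ℝ) * t)
      (by positivity) (by positivity) hq (by linarith)
    have e1 : (192 * (n : ℝ) ^ (1 - 2 * r)) ^ (2 * (p - 1))
        = 192 ^ (2 * (p - 1)) * (n : ℝ) ^ ((1 - 2 * r) * (2 * (p - 1))) := by
      rw [Real.mul_rpow (by norm_num) (by positivity), ← Real.rpow_mul hn0.le]
    have e2 : (192 * (n : ℝ) ^ ((1 - 4 * r) / 2) * Λ ^ (1 / 2 : ℝ) * t) ^ (2 * (p - 1))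
        = 192 ^ (2 * (p - 1)) * ((n : ℝ) ^ ((1 - 4 * r) / 2 * (2 * (p - 1)))
          * Λ ^ (p - 1) * t ^ (2 * (p - 1))) := by
      rw [Real.mul_rpow (by positivity) ht.le, Real.mul_rpow (by positivity) (by positivity),
        Real.mul_rpow (by norm_num) (by positivity), ← Real.rpow_mul hn0.le, ← Real.rpow_mul hΛ0,
        show (1 / 2 : ℝ) * (2 * (p - 1)) = p - 1 by ring]
      ring
    rw [e1, e2, ← mul_add] at h1
    have e3 : (n : ℝ) ^ ((1 - 2 * r) * (3 - 2 * p)) * (n : ℝ) ^ ((1 - 2 * r) * (2 * (p - 1)))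
        = (n : ℝ) ^ (1 - 2 * r) := by
      rw [← Real.rpow_add hn0]; congr 1; ring
    have e4 : (n : ℝ) ^ ((1 - 2 * r) * (3 - 2 * p)) * (n : ℝ) ^ ((1 - 4 * r) / 2 * (2 * (p - 1)))
        = (n : ℝ) ^ (2 - 2 * r - p) := by
      rw [← Real.rpow_add hn0]; congr 1; ring
    calc _ ≤ 100 * (n : ℝ) ^ ((1 - 2 * r) * (3 - 2 * p)) * (192 ^ (2 * (p - 1))
            * ((n : ℝ) ^ ((1 - 2 * r) * (2 * (p - 1)))
              + (n : ℝ) ^ ((1 - 4 * r) / 2 * (2 * (p - 1))) * Λ ^ (p - 1) * t ^ (2 * (p - 1)))) := by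
          gcongr
      _ = 100 * 192 ^ (2 * (p - 1)) * ((n : ℝ) ^ (1 - 2 * r)
            + (n : ℝ) ^ (2 - 2 * r - p) * Λ ^ (p - 1) * t ^ (2 * (p - 1))) := by
          rw [← e3, ← e4]; ring
      _ ≤ 10000000 * ((n : ℝ) ^ (1 - 2 * r)
            + (n : ℝ) ^ (2 - 2 * r - p) * Λ ^ (p - 1) * t ^ (2 * (p - 1))) := by
          gcongr
          linarith
      _ = _ := by ring

/-! ### The critical line `p = 2(1 - r)` with `(1 - 2r) ln n < e` -/

/-- On the critical line 2r = 2-p, so each term is (x_[i]²)^{p-1} (1/i)^{2-p} and Hölder with θ =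
p-1 separates the Euclidean norm from the harmonic sum. -/
lemma gradFun_le_norm {n : ℕ} (hn : 3 ≤ n) {r p : ℝ} (hr4 : 1 / 4 < r) (hr2 : r ≤ 1 / 2)
    (hp : p = 2 * (1 - r)) (x : EuclideanSpace ℝ (Fin n)) :
    gradFun r p x ≤ 2 * Real.log n * ‖x‖ ^ (2 * (p - 1)) := by
  have hl := one_le_log_of_three_le hn
  have h := sum_rpow_mul_rpow_le (Finset.Icc 1 n) (θ := p - 1)
    (f := fun i => decr x i ^ 2) (g := fun i => (i : ℝ)⁻¹)
    (by linarith) (by linarith) (fun i _ => sq_nonneg _) (fun i _ => by positivity)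
  have e : ∀ z : ℝ, 0 ≤ z → (z ^ 2) ^ (p - 1) = z ^ (2 * (p - 1)) := fun z hz => by
    rw [← Real.rpow_natCast, ← Real.rpow_mul hz]; norm_num
  have h1 : gradFun r p x
      = ∑ i ∈ Finset.Icc 1 n, (decr x i ^ 2) ^ (p - 1) * ((i : ℝ)⁻¹) ^ (1 - (p - 1)) := by
    unfold gradFun
    refine Finset.sum_congr rfl fun i _ => ?_
    rw [e _ (decr_nonneg x i), Real.inv_rpow i.cast_nonneg, ← Real.rpow_neg i.cast_nonneg,
      show -(1 - (p - 1)) = -(2 * r) by rw [hp]; ring, mul_comm]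
  rw [h1]
  refine h.trans ?_
  rw [sum_decr_sq_eq_norm_sq, e _ (norm_nonneg x), mul_comm]
  refine mul_le_mul_of_nonneg_right ?_ (Real.rpow_nonneg (norm_nonneg x) _)
  have h0 : 0 ≤ ∑ i ∈ Finset.Icc 1 n, (i : ℝ)⁻¹ := Finset.sum_nonneg fun i _ => by positivity
  calc _ ≤ (2 * Real.log n) ^ (1 - (p - 1)) :=
        Real.rpow_le_rpow h0 (by linarith [sum_inv_le_one_add_log n]) (by linarith)
    _ ≤ 2 * Real.log n := Real.rpow_le_self_of_one_le (by linarith) (by linarith)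

lemma exp_exp_one_le : Real.exp (Real.exp 1) ≤ 27 := by
  calc Real.exp (Real.exp 1) ≤ Real.exp 3 := Real.exp_le_exp.mpr Real.exp_one_lt_three.le
    _ = Real.exp 1 ^ 3 := by rw [← Real.exp_nat_mul]; norm_num
    _ ≤ 3 ^ 3 := by gcongr; exact Real.exp_one_lt_three.le
    _ = 27 := by norm_num

lemma regime_critical_euclidean {n : ℕ} (hn : 3 ≤ n) {Ω : Type*} [MeasurableSpace Ω]
    {P : Measure Ω} {X : Ω → EuclideanSpace ℝ (Fin n)}
    (hX : HasLaw X (stdGaussian (EuclideanSpace ℝ (Fin n))) P) {r p t : ℝ}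
    (ht : 0 < t) (hr4 : 1 / 4 < r) (hr2 : r ≤ 1 / 2) (hp : p = 2 * (1 - r))
    (hs : (1 - 2 * r) * Real.log n < Real.exp 1) :
    p < 3 / 2 ∧
    (∀ x : EuclideanSpace ℝ (Fin n),
      gradFun r p x ≤ 100 * Real.log n * ‖x‖ ^ (2 * (p - 1))) ∧
    TailAndBound P X 1 r p t (fun x => ‖x‖) (threshIVb 192 n t)
      (100 * Real.log n * threshIVb 192 n t ^ (2 * (p - 1))) ∧
    100 * Real.log n * threshIVb 192 n t ^ (2 * (p - 1))
      ≤ 10000000 * Real.log n * (1 + t ^ (2 * (p - 1))) ∧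
    (1 ≤ t → 100 * Real.log n * threshIVb 192 n t ^ (2 * (p - 1))
        ≤ 10000000 * Real.log n * t ^ (2 * (p - 1))) := by
  have hl := one_le_log_of_three_le hn
  have hn0 : (0 : ℝ) < n := by positivity
  have hgrad : ∀ x : EuclideanSpace ℝ (Fin n),
      gradFun r p x ≤ 100 * Real.log n * ‖x‖ ^ (2 * (p - 1)) := fun x => by
    refine (gradFun_le_norm hn hr4 hr2 hp x).trans ?_
    gcongr
    norm_num
  have hq : 0 ≤ 2 * (p - 1) := by linarith
  have hS : threshIVb 192 n t ^ (2 * (p - 1)) ≤ 192 * 27 * (1 + t ^ (2 * (p - 1))) := by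
    unfold threshIVb
    have htq := Real.rpow_pos_of_pos ht (2 * (p - 1))
    have h1 := Real.rpow_add_le_add_rpow (a := 192 * (n : ℝ) ^ (1 / 2 : ℝ)) (b := t)
      (by positivity) ht.le hq (by linarith)
    have h2 : (192 * (n : ℝ) ^ (1 / 2 : ℝ)) ^ (2 * (p - 1)) ≤ 192 * 27 := by
      rw [Real.mul_rpow (by norm_num) (by positivity), ← Real.rpow_mul hn0.le]
      -- The power equals n^{1-2r} = e^{(1-2r) ln n}, below e^e by the assumption of this sub-case.
      have h3 : (n : ℝ) ^ (1 / 2 * (2 * (p - 1))) ≤ 27 := by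
        refine le_trans ?_ exp_exp_one_le
        rw [Real.rpow_def_of_pos hn0]
        refine Real.exp_le_exp.mpr (le_trans (le_of_eq ?_) hs.le)
        rw [hp]; ring
      have h4 : (192 : ℝ) ^ (2 * (p - 1)) ≤ 192 :=
        Real.rpow_le_self_of_one_le (by norm_num) (by linarith)
      gcongr
    linarith
  refine ⟨by linarith, hgrad, ⟨?_, fun x hx => (hgrad x).trans ?_⟩, ?_, fun h1 => ?_⟩
  · rw [one_mul]
    refine one_sub_le_measureReal_of_law hX (G := {x | ‖x‖ < threshIVb 192 n t})
      (measurableSet_lt (by fun_prop) (by fun_prop)) ?_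
      (p := fun x => ‖x‖ ≤ threshIVb 192 n t) fun x hx => le_of_lt hx
    have h1 := stdGaussian_norm_tail (n := n) (by omega) (C := 192) (by norm_num) ht
    refine le_trans (le_of_eq ?_) h1
    congr 1
    ext x
    simp [threshIVb]
  · have h1 : ‖x‖ ^ (2 * (p - 1)) ≤ threshIVb 192 n t ^ (2 * (p - 1)) :=
      Real.rpow_le_rpow (norm_nonneg x) hx hq
    gcongr
  · have htq := Real.rpow_pos_of_pos ht (2 * (p - 1))
    calc _ ≤ 100 * Real.log n * (192 * 27 * (1 + t ^ (2 * (p - 1)))) := by gcongr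
      _ = 518400 * (Real.log n * (1 + t ^ (2 * (p - 1)))) := by ring
      _ ≤ 10000000 * (Real.log n * (1 + t ^ (2 * (p - 1)))) := by gcongr; norm_num
      _ = _ := by ring
  · have htq : 1 ≤ t ^ (2 * (p - 1)) := Real.one_le_rpow h1 hq
    calc _ ≤ 100 * Real.log n * (192 * 27 * (1 + t ^ (2 * (p - 1)))) := by gcongr
      _ ≤ 100 * Real.log n * (192 * 27 * (2 * t ^ (2 * (p - 1)))) := by gcongr; linarith
      _ = 1036800 * (Real.log n * t ^ (2 * (p - 1))) := by ring
      _ ≤ 10000000 * (Real.log n * t ^ (2 * (p - 1))) := by gcongr; norm_num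
      _ = _ := by ring

/-! ### The critical line `p = 2(1 - r)` with `(1 - 2r) ln n ≥ e` -/

/-- The factor `(1-2r)^p ln n / n^{1-2r}` in the definition of `betaSeq`. -/
noncomputable def betaFactor (n : ℕ) (r p : ℝ) : ℝ := (1 - 2 * r) ^ p * Real.log n / (n : ℝ) ^ (1 - 2 * r)

lemma betaFactor_pos {n : ℕ} (hn : 3 ≤ n) {r : ℝ} (hr2 : r < 1 / 2) (p : ℝ) :
    0 < betaFactor n r p := by
  have hl := one_le_log_of_three_le hn
  have hn0 : (0 : ℝ) < n := by positivity
  have hs : 0 < 1 - 2 * r := by linarith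
  unfold betaFactor
  positivity

lemma betaSeq_eq {n i : ℕ} {r p : ℝ} (hp : p = 2 * (1 - r)) (hi : i ∈ upToNDivE n) :
    betaSeq n r p i = (i : ℝ)⁻¹ *
      (1 + betaFactor n r p * ((i : ℝ) * Real.log ((n : ℝ) / i)) ^ (1 - 2 * r)) := by
  have hi0 : (0 : ℝ) < i := by exact_mod_cast (mem_upToNDivE.mp hi).1
  have hL := one_le_log_div hi
  unfold betaSeq
  rw [← betaFactor, Real.mul_rpow hi0.le (by linarith), show p - 1 = 1 - 2 * r by rw [hp]; ring,
    show -(2 * r) = (1 - 2 * r) - 1 by ring, Real.rpow_sub hi0, Real.rpow_one]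
  ring

lemma betaSeq_pos {n i : ℕ} (hn : 3 ≤ n) {r p : ℝ} (hr2 : r < 1 / 2) (hp : p = 2 * (1 - r))
    (hi : i ∈ upToNDivE n) : 0 < betaSeq n r p i := by
  have hi0 : (0 : ℝ) < i := by exact_mod_cast (mem_upToNDivE.mp hi).1
  have hL := one_le_log_div hi
  have hL0 : 0 < Real.log ((n : ℝ) / i) := by linarith
  have := betaFactor_pos hn hr2 p
  rw [betaSeq_eq hp hi]
  positivity

/-- Factoring 1/i out of β_i makes the powers of i collapse to i^{-1/2}. The other factor is a
non-positive power of a quantity increasing in i; monotonicity and the ℓ² bound both follow from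
this form. -/
lemma coeffIVa_eq {n i : ℕ} (hn : 3 ≤ n) {r p : ℝ} (hr2 : r < 1 / 2) (hp : p = 2 * (1 - r))
    (hi : i ∈ upToNDivE n) :
    coeffIVa n r p i =
      (1 + betaFactor n r p * ((i : ℝ) * Real.log ((n : ℝ) / i)) ^ (1 - 2 * r))
        ^ (-(3 - 2 * p) / (2 * (p - 1))) * (i : ℝ) ^ (-(1 / 2) : ℝ) := by
  have hi0 : (0 : ℝ) < i := by exact_mod_cast (mem_upToNDivE.mp hi).1
  have hL := one_le_log_div hi
  have hL0 : 0 < Real.log ((n : ℝ) / i) := by linarith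
  have := betaFactor_pos hn hr2 p
  have hs : 1 - 2 * r ≠ 0 := by linarith
  unfold coeffIVa
  rw [betaSeq_eq hp hi, Real.mul_rpow (by positivity) (by positivity),
    ← Real.rpow_neg_one (i : ℝ), ← Real.rpow_mul hi0.le, mul_right_comm, ← Real.rpow_add hi0,
    mul_comm]
  congr 2
  rw [show p - 1 = 1 - 2 * r by rw [hp]; ring, hp]
  field_simp
  ring

lemma coeffIVa_exponent_nonpos {r p : ℝ} (hr4 : 1 / 4 < r) (hr2 : r < 1 / 2)
    (hp : p = 2 * (1 - r)) : -(3 - 2 * p) / (2 * (p - 1)) ≤ 0 :=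
  div_nonpos_of_nonpos_of_nonneg (by linarith) (by linarith)

lemma coeffIVa_pos {n i : ℕ} (hn : 3 ≤ n) {r p : ℝ} (hr2 : r < 1 / 2) (hp : p = 2 * (1 - r))
    (hi : i ∈ upToNDivE n) : 0 < coeffIVa n r p i := by
  have hi0 : (0 : ℝ) < i := by exact_mod_cast (mem_upToNDivE.mp hi).1
  have := betaSeq_pos hn hr2 hp hi
  unfold coeffIVa
  positivity

lemma coeffIVa_antitone {n : ℕ} (hn : 3 ≤ n) {r p : ℝ} (hr4 : 1 / 4 < r) (hr2 : r < 1 / 2)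
    (hp : p = 2 * (1 - r)) {i j : ℕ} (hi : 1 ≤ i) (hij : i ≤ j) (hj : j ∈ upToNDivE n) :
    coeffIVa n r p j ≤ coeffIVa n r p i := by
  have hij' : (i : ℝ) ≤ j := by exact_mod_cast hij
  have him : i ∈ upToNDivE n := mem_upToNDivE.mpr ⟨hi, hij'.trans (mem_upToNDivE.mp hj).2⟩
  have hi0 : (0 : ℝ) < i := by exact_mod_cast hi
  have hL := one_le_log_div him
  have hL0 : 0 < Real.log ((n : ℝ) / i) := by linarith
  have hA := betaFactor_pos hn hr2 p
  rw [coeffIVa_eq hn hr2 hp him, coeffIVa_eq hn hr2 hp hj]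
  have hmono := mul_log_div_mono hi hij hj
  refine mul_le_mul ?_ ?_ ?_ ?_
  · refine Real.rpow_le_rpow_of_nonpos (by positivity) ?_ (coeffIVa_exponent_nonpos hr4 hr2 hp)
    have := Real.rpow_le_rpow (by positivity) hmono (show 0 ≤ 1 - 2 * r by linarith)
    gcongr
  · exact Real.rpow_le_rpow_of_nonpos hi0 hij' (by norm_num)
  · positivity
  · positivity

/-- The summand 1/i in β_i is there for this: it keeps the ℓ² norm of the coefficients, hence the
factor of t, of order (ln n)^{1/2}. -/
lemma coeffIVa_sq_le {n i : ℕ} (hn : 3 ≤ n) {r p : ℝ} (hr4 : 1 / 4 < r) (hr2 : r < 1 / 2)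
    (hp : p = 2 * (1 - r)) (hi : i ∈ upToNDivE n) : coeffIVa n r p i ^ 2 ≤ (i : ℝ)⁻¹ := by
  have hi0 : (0 : ℝ) < i := by exact_mod_cast (mem_upToNDivE.mp hi).1
  have hL := one_le_log_div hi
  have hL0 : 0 < Real.log ((n : ℝ) / i) := by linarith
  have hA := betaFactor_pos hn hr2 p
  have h1 : coeffIVa n r p i ≤ (i : ℝ) ^ (-(1 / 2) : ℝ) := by
    rw [coeffIVa_eq hn hr2 hp hi]
    refine mul_le_of_le_one_left (by positivity) ?_
    refine Real.rpow_le_one_of_one_le_of_nonpos ?_ (coeffIVa_exponent_nonpos hr4 hr2 hp)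
    have : 0 ≤ betaFactor n r p * ((i : ℝ) * Real.log ((n : ℝ) / i)) ^ (1 - 2 * r) := by positivity
    linarith
  refine (pow_le_pow_left₀ (coeffIVa_pos hn hr2 hp hi).le h1 2).trans (le_of_eq ?_)
  rw [← Real.rpow_natCast, ← Real.rpow_mul hi0.le, ← Real.rpow_neg_one]
  norm_num

/-- Here the other summand of β_i is kept and 1/i is dropped. With κ the exponent of β_i, (1-2r)κ =
(1-2r) - 1/2, so the terms become those of the logarithmically weighted power sum. -/
lemma coeffIVa_mul_le {n i : ℕ} (hn : 3 ≤ n) {r p : ℝ} (hr4 : 1 / 4 < r) (hr2 : r < 1 / 2)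
    (hp : p = 2 * (1 - r)) (hi : i ∈ upToNDivE n) :
    coeffIVa n r p i * (1 + Real.log ((n : ℝ) / i)) ^ (1 / 2 : ℝ)
      ≤ 2 * betaFactor n r p ^ (-(3 - 2 * p) / (2 * (p - 1))) *
        ((i : ℝ) ^ ((1 - 2 * r) - 1) * (1 + Real.log ((n : ℝ) / i)) ^ (p - 1)) := by
  have hi0 : (0 : ℝ) < i := by exact_mod_cast (mem_upToNDivE.mp hi).1
  have hL := one_le_log_div hi
  have hA := betaFactor_pos hn hr2 p
  have hs : 0 < 1 - 2 * r := by linarith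
  rw [coeffIVa_eq hn hr2 hp hi]
  set A := betaFactor n r p
  set u := Real.log ((n : ℝ) / i)
  set κ := -(3 - 2 * p) / (2 * (p - 1)) with hκ
  have hκ0 : κ ≤ 0 := coeffIVa_exponent_nonpos hr4 hr2 hp
  have hu0 : 0 < u := by linarith
  have hsκ : (1 - 2 * r) * κ = (1 - 2 * r) - 1 / 2 := by
    rw [hκ, show p - 1 = 1 - 2 * r by rw [hp]; ring, hp]
    field_simp
    ring
  have h1 : (1 + A * (i * u) ^ (1 - 2 * r)) ^ κ
      ≤ A ^ κ * ((i : ℝ) ^ ((1 - 2 * r) - 1 / 2) * u ^ ((1 - 2 * r) - 1 / 2)) := by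
    calc _ ≤ (A * (i * u) ^ (1 - 2 * r)) ^ κ :=
          Real.rpow_le_rpow_of_nonpos (by positivity) (by linarith) hκ0
      _ = _ := by
          rw [Real.mul_rpow hA.le (by positivity), ← Real.rpow_mul (by positivity), hsκ,
            Real.mul_rpow hi0.le hu0.le]
  have h2 : (1 + u) ^ (1 / 2 : ℝ) ≤ 2 * u ^ (1 / 2 : ℝ) :=
    rpow_half_le_mul_rpow_half (by norm_num) (by linarith)
  have h3 : u ^ (p - 1) ≤ (1 + u) ^ (p - 1) :=
    Real.rpow_le_rpow hu0.le (by linarith) (by linarith)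
  have e1 : (i : ℝ) ^ ((1 - 2 * r) - 1 / 2) * (i : ℝ) ^ (-(1 / 2) : ℝ)
      = (i : ℝ) ^ ((1 - 2 * r) - 1) := by
    rw [← Real.rpow_add hi0]; congr 1; ring
  have e2 : u ^ ((1 - 2 * r) - 1 / 2) * u ^ (1 / 2 : ℝ) = u ^ (p - 1) := by
    rw [← Real.rpow_add hu0]; congr 1; rw [hp]; ring
  calc _ ≤ A ^ κ * ((i : ℝ) ^ ((1 - 2 * r) - 1 / 2) * u ^ ((1 - 2 * r) - 1 / 2))
        * (i : ℝ) ^ (-(1 / 2) : ℝ) * (2 * u ^ (1 / 2 : ℝ)) := by gcongr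
    _ = 2 * A ^ κ * (((i : ℝ) ^ ((1 - 2 * r) - 1 / 2) * (i : ℝ) ^ (-(1 / 2) : ℝ))
        * (u ^ ((1 - 2 * r) - 1 / 2) * u ^ (1 / 2 : ℝ))) := by ring
    _ = 2 * A ^ κ * ((i : ℝ) ^ ((1 - 2 * r) - 1) * u ^ (p - 1)) := by rw [e1, e2]
    _ ≤ _ := by gcongr

lemma rpow_mul_log_sum_le_critical {n : ℕ} {r p : ℝ} (hr4 : 1 / 4 < r) (hr2 : r < 1 / 2)
    (hp : p = 2 * (1 - r)) :
    ∑ i ∈ Finset.Icc 1 n, (i : ℝ) ^ ((1 - 2 * r) - 1) * (1 + Real.log ((n : ℝ) / i)) ^ (p - 1)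
      ≤ 12 * (1 - 2 * r) ^ (-p) * (n : ℝ) ^ (1 - 2 * r) := by
  have hs : 0 < 1 - 2 * r := by linarith
  refine (rpow_mul_log_sum_le_div hs (by linarith) (by linarith)).trans ?_
  have h1 : (2 * p) ^ p ≤ 6 := by
    calc (2 * p) ^ p ≤ 3 ^ p := Real.rpow_le_rpow (by linarith) (by linarith) (by linarith)
      _ ≤ 3 ^ (3 / 2 : ℝ) := Real.rpow_le_rpow_of_exponent_le (by norm_num) (by linarith)
      _ = √(3 ^ 3) := by
          rw [Real.sqrt_eq_rpow, ← Real.rpow_natCast, ← Real.rpow_mul (by norm_num)]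
          norm_num
      _ ≤ 6 := by
          rw [Real.sqrt_le_left (by norm_num)]; norm_num
  have hsp := Real.rpow_pos_of_pos hs (-p)
  rw [Real.div_rpow (by linarith) hs.le, div_eq_mul_inv, ← Real.rpow_neg hs.le]
  calc _ = 2 * (2 * p) ^ p * ((1 - 2 * r) ^ (-p) * (n : ℝ) ^ (1 - 2 * r)) := by ring
    _ ≤ 2 * 6 * ((1 - 2 * r) ^ (-p) * (n : ℝ) ^ (1 - 2 * r)) := by gcongr
    _ = _ := by ring

/-- The factor in `betaSeq` normalises the first summand so that its total is at most 12 ln n,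
matching the order of the harmonic part. -/
lemma sum_betaSeq_le {n : ℕ} (hn : 3 ≤ n) {r p : ℝ} (hr4 : 1 / 4 < r) (hr2 : r < 1 / 2)
    (hp : p = 2 * (1 - r)) : ∑ i ∈ upToNDivE n, betaSeq n r p i ≤ 14 * Real.log n := by
  have hl := one_le_log_of_three_le hn
  have hn0 : (0 : ℝ) < n := by positivity
  have hs : 0 < 1 - 2 * r := by linarith
  have hA := betaFactor_pos hn hr2 p
  have h1 : ∑ i ∈ upToNDivE n, betaSeq n r p i
      ≤ betaFactor n r p * ∑ i ∈ Finset.Icc 1 n,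
        (i : ℝ) ^ ((1 - 2 * r) - 1) * (1 + Real.log ((n : ℝ) / i)) ^ (p - 1)
        + ∑ i ∈ Finset.Icc 1 n, (i : ℝ)⁻¹ := by
    rw [Finset.mul_sum, ← Finset.sum_add_distrib]
    refine (Finset.sum_le_sum fun i hi => ?_).trans
      (Finset.sum_le_sum_of_subset_of_nonneg (upToNDivE_subset n) fun i hi _ => ?_)
    · have hL := one_le_log_div hi
      unfold betaSeq
      rw [← betaFactor, show -(2 * r) = (1 - 2 * r) - 1 by ring, mul_assoc]
      have h3 : Real.log ((n : ℝ) / i) ^ (p - 1) ≤ (1 + Real.log ((n : ℝ) / i)) ^ (p - 1) :=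
        Real.rpow_le_rpow (by linarith) (by linarith) (by linarith)
      gcongr
    · rw [Finset.mem_Icc] at hi
      have := one_le_one_add_log_div hi.1 hi.2
      have : 0 ≤ 1 + Real.log ((n : ℝ) / i) := by linarith
      positivity
  have h2 := mul_le_mul_of_nonneg_left (rpow_mul_log_sum_le_critical (n := n) hr4 hr2 hp) hA.le
  have e : betaFactor n r p * (12 * (1 - 2 * r) ^ (-p) * (n : ℝ) ^ (1 - 2 * r))
      = 12 * Real.log n := by
    unfold betaFactor
    rw [Real.rpow_neg hs.le]
    have h5 := (Real.rpow_pos_of_pos hs p).ne'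
    have h6 := (Real.rpow_pos_of_pos hn0 (1 - 2 * r)).ne'
    field_simp
  linarith [sum_inv_le_one_add_log n]

lemma normIVa_nonneg {n : ℕ} (hn : 3 ≤ n) {r p : ℝ} (hr2 : r < 1 / 2) (hp : p = 2 * (1 - r))
    (x : EuclideanSpace ℝ (Fin n)) : 0 ≤ normIVa r p x :=
  Finset.sum_nonneg fun i hi => mul_nonneg (coeffIVa_pos hn hr2 hp hi).le (decr_nonneg x i)

lemma isNormOn_normIVa {n : ℕ} (hn : 3 ≤ n) {r p : ℝ} (hr4 : 1 / 4 < r) (hr2 : r < 1 / 2)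
    (hp : p = 2 * (1 - r)) : IsNormOn (n := n) (normIVa r p) :=
  isNormOn_weighted_one (one_le_floor_div_exp hn) (floor_div_exp_le n)
    (fun _ _ hi hij hj => coeffIVa_antitone hn hr4 hr2 hp hi hij
      (mem_upToNDivE_of_le_floor (hi.trans hij) hj))
    (fun _ hi him => (coeffIVa_pos hn hr2 hp (mem_upToNDivE_of_le_floor hi him)).le)
    (coeffIVa_pos hn hr2 hp (mem_upToNDivE_of_le_floor le_rfl (one_le_floor_div_exp hn)))

lemma gradFun_le_normIVa {n : ℕ} (hn : 3 ≤ n) {r p : ℝ} (hr4 : 1 / 4 < r) (hr2 : r < 1 / 2)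
    (hp : p = 2 * (1 - r)) (x : EuclideanSpace ℝ (Fin n)) :
    gradFun r p x ≤ 100 * Real.log n ^ (3 - 2 * p) * normIVa r p x ^ (2 * (p - 1)) := by
  have hl := one_le_log_of_three_le hn
  have hp1 : 0 < p - 1 := by linarith
  have h := sum_rpow_mul_rpow_le (upToNDivE n) (θ := 2 * (p - 1))
    (f := fun i => coeffIVa n r p i * decr x i) (g := fun i => betaSeq n r p i)
    (by linarith) (by linarith)
    (fun i hi => mul_nonneg (coeffIVa_pos hn hr2 hp hi).le (decr_nonneg x i))
    (fun i hi => (betaSeq_pos hn hr2 hp hi).le)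
  rw [show 1 - 2 * (p - 1) = 3 - 2 * p by ring] at h
  have e : ∑ i ∈ upToNDivE n, (i : ℝ) ^ (-(2 * r)) * decr x i ^ (2 * (p - 1))
      = ∑ i ∈ upToNDivE n, (coeffIVa n r p i * decr x i) ^ (2 * (p - 1))
        * betaSeq n r p i ^ (3 - 2 * p) := by
    refine Finset.sum_congr rfl fun i hi => ?_
    have hi0 : (0 : ℝ) < i := by exact_mod_cast (mem_upToNDivE.mp hi).1
    have hb := betaSeq_pos hn hr2 hp hi
    rw [Real.mul_rpow (coeffIVa_pos hn hr2 hp hi).le (decr_nonneg x i), coeffIVa]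
    set b := betaSeq n r p i
    rw [Real.mul_rpow (by positivity) (by positivity), ← Real.rpow_mul hb.le,
      ← Real.rpow_mul hi0.le,
      show -(3 - 2 * p) / (2 * (p - 1)) * (2 * (p - 1)) = -(3 - 2 * p) by field_simp,
      show -r / (p - 1) * (2 * (p - 1)) = -(2 * r) by field_simp, Real.rpow_neg hb.le]
    have := (Real.rpow_pos_of_pos hb (3 - 2 * p)).ne'
    field_simp
  have hβ0 : 0 ≤ ∑ i ∈ upToNDivE n, betaSeq n r p i :=
    Finset.sum_nonneg fun i hi => (betaSeq_pos hn hr2 hp hi).le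
  have h14 : (14 : ℝ) ^ (3 - 2 * p) ≤ 14 :=
    Real.rpow_le_self_of_one_le (by norm_num) (by linarith)
  have hN := Real.rpow_nonneg (normIVa_nonneg hn hr2 hp x) (2 * (p - 1))
  calc gradFun r p x
      ≤ 6 * ∑ i ∈ upToNDivE n, (i : ℝ) ^ (-(2 * r)) * decr x i ^ (2 * (p - 1)) :=
        gradFun_le_six_mul hn (by linarith) (by linarith) x
    _ ≤ 6 * (normIVa r p x ^ (2 * (p - 1)) * (14 * Real.log n) ^ (3 - 2 * p)) := by
        rw [e]
        refine mul_le_mul_of_nonneg_left (h.trans ?_) (by norm_num)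
        exact mul_le_mul_of_nonneg_left
          (Real.rpow_le_rpow hβ0 (sum_betaSeq_le hn hr4 hr2 hp) (by linarith)) hN
    _ = 6 * 14 ^ (3 - 2 * p) * (Real.log n ^ (3 - 2 * p) * normIVa r p x ^ (2 * (p - 1))) := by
        rw [Real.mul_rpow (by norm_num) (by linarith)]; ring
    _ ≤ 100 * (Real.log n ^ (3 - 2 * p) * normIVa r p x ^ (2 * (p - 1))) := by
        gcongr
        linarith
    _ = _ := by ring

lemma normIVa_le_threshIVa {n : ℕ} (hn : 3 ≤ n) {r p t : ℝ} (hr4 : 1 / 4 < r) (hr2 : r < 1 / 2)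
    (hp : p = 2 * (1 - r)) (ht : 0 < t) {x : EuclideanSpace ℝ (Fin n)}
    (hx : SumSqBound n 12 t (decr x)) : normIVa r p x ≤ threshIVa 192 n r p t := by
  have hl := one_le_log_of_three_le hn
  have hn0 : (0 : ℝ) < n := by positivity
  have hs : 0 < 1 - 2 * r := by linarith
  have hA := betaFactor_pos hn hr2 p
  have h := hx.sum_mul_le ht.le (decr_nonneg x) (fun i j hi hij hj => decr_le_decr x hi hij hj)
    (upToNDivE_subset n) (w := coeffIVa n r p) (fun i hi => (coeffIVa_pos hn hr2 hp hi).le)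
  have h1 : (∑ i ∈ upToNDivE n, coeffIVa n r p i ^ 2) ^ (1 / 2 : ℝ)
      ≤ 2 * Real.log n ^ (1 / 2 : ℝ) := by
    refine rpow_half_le_mul_rpow_half (by norm_num) ?_
    calc _ ≤ ∑ i ∈ upToNDivE n, (i : ℝ)⁻¹ :=
          Finset.sum_le_sum fun i hi => coeffIVa_sq_le hn hr4 hr2 hp hi
      _ ≤ ∑ i ∈ Finset.Icc 1 n, (i : ℝ)⁻¹ :=
          Finset.sum_le_sum_of_subset_of_nonneg (upToNDivE_subset n) fun i _ _ => by positivity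
      _ ≤ _ := by linarith [sum_inv_le_one_add_log n]
  set κ := -(3 - 2 * p) / (2 * (p - 1)) with hκ
  have h2 : ∑ i ∈ upToNDivE n, coeffIVa n r p i * (1 + Real.log ((n : ℝ) / i)) ^ (1 / 2 : ℝ)
      ≤ 2 * betaFactor n r p ^ κ * (12 * (1 - 2 * r) ^ (-p) * (n : ℝ) ^ (1 - 2 * r)) := by
    refine (Finset.sum_le_sum fun i hi => coeffIVa_mul_le hn hr4 hr2 hp hi).trans ?_
    rw [← Finset.mul_sum]
    refine mul_le_mul_of_nonneg_left ?_ (by positivity)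
    refine le_trans (Finset.sum_le_sum_of_subset_of_nonneg (upToNDivE_subset n) fun i hi _ => ?_)
      (rpow_mul_log_sum_le_critical hr4 hr2 hp)
    rw [Finset.mem_Icc] at hi
    have := one_le_one_add_log_div hi.1 hi.2
    have : 0 ≤ 1 + Real.log ((n : ℝ) / i) := by linarith
    positivity
  have e : betaFactor n r p ^ κ * ((1 - 2 * r) ^ (-p) * (n : ℝ) ^ (1 - 2 * r))
      = (1 - 2 * r) ^ (-p / (2 * (p - 1))) * Real.log n ^ κ * (n : ℝ) ^ (1 / 2 : ℝ) := by
    unfold betaFactor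
    rw [Real.div_rpow (by positivity) (by positivity), Real.mul_rpow (by positivity) (by linarith),
      ← Real.rpow_mul hs.le, ← Real.rpow_mul hn0.le, div_eq_mul_inv, ← Real.rpow_neg hn0.le]
    calc _ = ((1 - 2 * r) ^ (p * κ) * (1 - 2 * r) ^ (-p)) * Real.log n ^ κ
          * ((n : ℝ) ^ (-((1 - 2 * r) * κ)) * (n : ℝ) ^ (1 - 2 * r)) := by ring
      _ = _ := by
          rw [← Real.rpow_add hs, ← Real.rpow_add hn0]
          congr 3
          · rw [hκ, show p - 1 = 1 - 2 * r by rw [hp]; ring, hp]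
            field_simp
            ring
          · rw [hκ, show p - 1 = 1 - 2 * r by rw [hp]; ring, hp]
            field_simp
            ring
  -- Since 0 < p-1 ≤ 1, the power only increases 192, which already exceeds the absolute constants
  -- 5·24 and 5·2 needed here.
  have h192 : (192 : ℝ) ≤ 192 ^ (1 / (p - 1)) := by
    refine Real.self_le_rpow_of_one_le (by norm_num) ?_
    rw [le_div_iff₀ (by linarith)]
    linarith
  unfold threshIVa normIVa
  refine h.trans ?_
  have h3 := mul_le_mul_of_nonneg_right h1 ht.le
  have h4 : 0 ≤ Real.log n ^ (1 / 2 : ℝ) * t := by positivity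
  have h5 : 0 ≤ (1 - 2 * r) ^ (-p / (2 * (p - 1))) * Real.log n ^ κ * (n : ℝ) ^ (1 / 2 : ℝ) := by
    positivity
  have h6 := mul_le_mul_of_nonneg_right h192 h4
  have h7 := mul_le_mul_of_nonneg_right h192 h5
  have h8 : 2 * betaFactor n r p ^ κ * (12 * (1 - 2 * r) ^ (-p) * (n : ℝ) ^ (1 - 2 * r))
      = 24 * ((1 - 2 * r) ^ (-p / (2 * (p - 1))) * Real.log n ^ κ * (n : ℝ) ^ (1 / 2 : ℝ)) := by
    rw [← e]; ring
  rw [h8] at h2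
  rw [mul_assoc _ (Real.log n ^ κ), mul_assoc] at *
  linarith

/-- Bernoulli gives (1/s)^s ≤ 1 + s(1/s - 1) ≤ 2. With s = 1-2r and p = 1+s, this replaces
(1-2r)^{-p} by a multiple of (1-2r)^{-1}. -/
lemma rpow_neg_one_add_self_le {s : ℝ} (hs : 0 < s) (hs1 : s ≤ 1) :
    s ^ (-(1 + s)) ≤ 2 * s⁻¹ := by
  have h1 := rpow_one_add_le_one_add_mul_self (s := s⁻¹ - 1) (by
    have := inv_pos.mpr hs; linarith) hs.le hs1
  rw [add_sub_cancel, Real.inv_rpow hs.le, ← Real.rpow_neg hs.le] at h1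
  have h2 : 1 + s * (s⁻¹ - 1) ≤ 2 := by
    rw [mul_sub, mul_inv_cancel₀ hs.ne']; linarith
  rw [show -(1 + s) = -s + -1 by ring, Real.rpow_add hs, Real.rpow_neg_one]
  have := inv_pos.mpr hs
  gcongr
  linarith

lemma regime_critical {n : ℕ} (hn : 3 ≤ n) {Ω : Type*} [MeasurableSpace Ω]
    {P : Measure Ω} {X : Ω → EuclideanSpace ℝ (Fin n)}
    (hX : HasLaw X (stdGaussian (EuclideanSpace ℝ (Fin n))) P) {r p t : ℝ}
    (ht : 0 < t) (hr4 : 1 / 4 < r) (hp : p = 2 * (1 - r))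
    (hse : Real.exp 1 ≤ (1 - 2 * r) * Real.log n) :
    1 < p ∧ p < 3 / 2 ∧
    (∀ i j : ℕ, 1 ≤ i → i ≤ j → (j : ℝ) ≤ (n : ℝ) / Real.exp 1 →
      coeffIVa n r p j ≤ coeffIVa n r p i) ∧
    IsNormOn (n := n) (normIVa r p) ∧
    (∀ x : EuclideanSpace ℝ (Fin n),
      gradFun r p x ≤ 100 * Real.log n ^ (3 - 2 * p) * normIVa r p x ^ (2 * (p - 1))) ∧
    TailAndBound P X 1 r p t (normIVa r p) (threshIVa 192 n r p t)
      (100 * Real.log n ^ (3 - 2 * p) * threshIVa 192 n r p t ^ (2 * (p - 1))) ∧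
    100 * Real.log n ^ (3 - 2 * p) * threshIVa 192 n r p t ^ (2 * (p - 1))
      ≤ explicitIVa 10000000 n r p t := by
  have hl := one_le_log_of_three_le hn
  have hl0 : 0 < Real.log n := by linarith
  have hn0 : (0 : ℝ) < n := by positivity
  have hs : 0 < 1 - 2 * r := by
    have := (Real.exp_pos 1).trans_le hse
    exact (pos_iff_pos_of_mul_pos this).mpr hl0
  have hr2 : r < 1 / 2 := by linarith
  have hp1 : 0 < p - 1 := by linarith
  refine ⟨by linarith, by linarith, fun i j hi hij hj => coeffIVa_antitone hn hr4 hr2 hp hi hij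
    (mem_upToNDivE.mpr ⟨hi.trans hij, hj⟩), isNormOn_normIVa hn hr4 hr2 hp,
    gradFun_le_normIVa hn hr4 hr2 hp, ⟨?_, fun x hx =>
      (gradFun_le_normIVa hn hr4 hr2 hp x).trans ?_⟩, ?_⟩
  · exact one_sub_le_measureReal_of_sumSqBound hX
      (p := fun x => normIVa r p x ≤ threshIVa 192 n r p t)
      fun x hx => normIVa_le_threshIVa hn hr4 hr2 hp ht hx
  · have h1 : normIVa r p x ^ (2 * (p - 1)) ≤ threshIVa 192 n r p t ^ (2 * (p - 1)) :=
      Real.rpow_le_rpow (normIVa_nonneg hn hr2 hp x) hx (by linarith)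
    gcongr
  · unfold threshIVa explicitIVa
    have h1 := Real.rpow_add_le_add_rpow
      (a := 192 ^ (1 / (p - 1)) * (1 - 2 * r) ^ (-p / (2 * (p - 1)))
        * Real.log n ^ (-(3 - 2 * p) / (2 * (p - 1))) * (n : ℝ) ^ (1 / 2 : ℝ))
      (b := 192 ^ (1 / (p - 1)) * Real.log n ^ (1 / 2 : ℝ) * t)
      (by positivity) (by positivity) (show 0 ≤ 2 * (p - 1) by linarith) (by linarith)
    -- The exponent 1/(p-1) on the constant is harmless: the power 2(p-1) turns it into 192²,
    -- independent of p.
    have e192 : ((192 : ℝ) ^ (1 / (p - 1))) ^ (2 * (p - 1)) = 192 ^ 2 := by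
      rw [← Real.rpow_mul (by norm_num), show 1 / (p - 1) * (2 * (p - 1)) = 2 by field_simp]
      norm_cast
    have e1 : (192 ^ (1 / (p - 1)) * (1 - 2 * r) ^ (-p / (2 * (p - 1)))
        * Real.log n ^ (-(3 - 2 * p) / (2 * (p - 1))) * (n : ℝ) ^ (1 / 2 : ℝ)) ^ (2 * (p - 1))
        = 192 ^ 2 * (1 - 2 * r) ^ (-p) * Real.log n ^ (-(3 - 2 * p))
          * (n : ℝ) ^ (1 - 2 * r) := by
      rw [Real.mul_rpow (by positivity) (by positivity),
        Real.mul_rpow (by positivity) (by positivity),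
        Real.mul_rpow (by positivity) (by positivity), e192, ← Real.rpow_mul hs.le,
        ← Real.rpow_mul hl0.le, ← Real.rpow_mul hn0.le,
        show -p / (2 * (p - 1)) * (2 * (p - 1)) = -p by field_simp,
        show -(3 - 2 * p) / (2 * (p - 1)) * (2 * (p - 1)) = -(3 - 2 * p) by field_simp,
        show 1 / 2 * (2 * (p - 1)) = 1 - 2 * r by rw [hp]; ring]
    have e2 : (192 ^ (1 / (p - 1)) * Real.log n ^ (1 / 2 : ℝ) * t) ^ (2 * (p - 1))
        = 192 ^ 2 * Real.log n ^ (p - 1) * t ^ (2 * (p - 1)) := by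
      rw [Real.mul_rpow (by positivity) ht.le, Real.mul_rpow (by positivity) (by positivity), e192,
        ← Real.rpow_mul hl0.le, show 1 / 2 * (2 * (p - 1)) = p - 1 by ring]
    rw [e1, e2] at h1
    have e3 : Real.log n ^ (3 - 2 * p) * Real.log n ^ (-(3 - 2 * p)) = 1 := by
      rw [← Real.rpow_add hl0, add_neg_cancel, Real.rpow_zero]
    have e4 : Real.log n ^ (3 - 2 * p) * Real.log n ^ (p - 1) = Real.log n ^ (2 - p) := by
      rw [← Real.rpow_add hl0]; congr 1; ring
    have h2 : (1 - 2 * r) ^ (-p) ≤ 2 * (1 - 2 * r)⁻¹ := by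
      have := rpow_neg_one_add_self_le hs (by linarith)
      rwa [show 1 + (1 - 2 * r) = p by rw [hp]; ring] at this
    have hT : 0 ≤ Real.log n ^ (2 - p) * t ^ (2 * (p - 1)) := by positivity
    calc _ ≤ 100 * Real.log n ^ (3 - 2 * p) * (192 ^ 2 * (1 - 2 * r) ^ (-p)
            * Real.log n ^ (-(3 - 2 * p)) * (n : ℝ) ^ (1 - 2 * r)
            + 192 ^ 2 * Real.log n ^ (p - 1) * t ^ (2 * (p - 1))) := by gcongr
      _ = 3686400 * (1 - 2 * r) ^ (-p) * (Real.log n ^ (3 - 2 * p) * Real.log n ^ (-(3 - 2 * p)))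
            * (n : ℝ) ^ (1 - 2 * r)
          + 3686400 * (Real.log n ^ (3 - 2 * p) * Real.log n ^ (p - 1)) * t ^ (2 * (p - 1)) := by
          ring
      _ = 3686400 * (1 - 2 * r) ^ (-p) * (n : ℝ) ^ (1 - 2 * r)
          + 3686400 * (Real.log n ^ (2 - p) * t ^ (2 * (p - 1))) := by rw [e3, e4]; ring
      _ ≤ 3686400 * (2 * (1 - 2 * r)⁻¹) * (n : ℝ) ^ (1 - 2 * r)
          + 10000000 * (Real.log n ^ (2 - p) * t ^ (2 * (p - 1))) := by
          gcongr
          norm_num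
      _ = 7372800 * ((1 - 2 * r)⁻¹ * (n : ℝ) ^ (1 - 2 * r))
          + 10000000 * (Real.log n ^ (2 - p) * t ^ (2 * (p - 1))) := by ring
      _ ≤ 10000000 * ((1 - 2 * r)⁻¹ * (n : ℝ) ^ (1 - 2 * r))
          + 10000000 * (Real.log n ^ (2 - p) * t ^ (2 * (p - 1))) := by
          gcongr
          norm_num
      _ = _ := by ring

theorem theorem7 :
    ∃ C₀ C₁ C₂ C₃ : ℝ, 0 < C₀ ∧ 0 < C₁ ∧ 0 < C₂ ∧ 0 < C₃ ∧
      ∀ (n : ℕ), 3 ≤ n →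
      ∀ (Ω : Type*) [MeasurableSpace Ω] (P : Measure Ω) (X : Ω → EuclideanSpace ℝ (Fin n)),
        HasLaw X (stdGaussian (EuclideanSpace ℝ (Fin n))) P →
      ∀ r p t : ℝ, 0 ≤ r → 1 ≤ p → 0 < t →
        -- first regime
        (3 / 2 ≤ p →
          IsNormOn (n := n) (normI r p) ∧
          boundI C₁ n r p t = threshI C₁ n r p t ^ (2 * (p - 1)) ∧
          TailAndBound P X C₀ r p t (normI r p) (threshI C₁ n r p t) (boundI C₁ n r p t)) ∧
        -- second regime
        (p < 3 / 2 →
          (∀ x : EuclideanSpace ℝ (Fin n),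
            gradFun r p x
              ≤ C₂ * weightSum n r p t ^ (3 - 2 * p) * normII r p t x ^ (2 * (p - 1))) ∧
          TailAndBound P X C₀ r p t (normII r p t)
            (threshII C₁ n r p t) (C₂ * threshII C₁ n r p t) ∧
          C₂ * threshII C₁ n r p t ≤ explicitII C₃ n r p t ∧
          (3 / 2 - 2 * r ≤ p → IsNormOn (n := n) (normII r p t))) ∧
        -- third regime
        (p < 3 / 2 - 2 * r →
          r < 1 / 4 ∧ p < 3 / 2 ∧
          IsNormOn (n := n) (normIII r) ∧
          (∀ x : EuclideanSpace ℝ (Fin n),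
            gradFun r p x
              ≤ C₂ * (n : ℝ) ^ ((1 - 2 * r) * (3 - 2 * p)) * normIII r x ^ (2 * (p - 1))) ∧
          TailAndBound P X C₀ r p t (normIII r) (threshIII C₁ n r t)
            (C₂ * (n : ℝ) ^ ((1 - 2 * r) * (3 - 2 * p)) * threshIII C₁ n r t ^ (2 * (p - 1))) ∧
          C₂ * (n : ℝ) ^ ((1 - 2 * r) * (3 - 2 * p)) * threshIII C₁ n r t ^ (2 * (p - 1))
            ≤ explicitIII C₃ n r p t) ∧
        -- fourth regime, first sub-case
        (1 / 4 < r → r ≤ 1 / 2 → p = 2 * (1 - r) → Real.exp 1 ≤ (1 - 2 * r) * Real.log n →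
          1 < p ∧ p < 3 / 2 ∧
          (∀ i j : ℕ, 1 ≤ i → i ≤ j → (j : ℝ) ≤ (n : ℝ) / Real.exp 1 →
            coeffIVa n r p j ≤ coeffIVa n r p i) ∧
          IsNormOn (n := n) (normIVa r p) ∧
          (∀ x : EuclideanSpace ℝ (Fin n),
            gradFun r p x
              ≤ C₂ * Real.log n ^ (3 - 2 * p) * normIVa r p x ^ (2 * (p - 1))) ∧
          TailAndBound P X C₀ r p t (normIVa r p) (threshIVa C₁ n r p t)
            (C₂ * Real.log n ^ (3 - 2 * p) * threshIVa C₁ n r p t ^ (2 * (p - 1))) ∧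
          C₂ * Real.log n ^ (3 - 2 * p) * threshIVa C₁ n r p t ^ (2 * (p - 1))
            ≤ explicitIVa C₃ n r p t) ∧
        -- fourth regime, second sub-case
        (1 / 4 < r → r ≤ 1 / 2 → p = 2 * (1 - r) → (1 - 2 * r) * Real.log n < Real.exp 1 →
          p < 3 / 2 ∧
          (∀ x : EuclideanSpace ℝ (Fin n),
            gradFun r p x ≤ C₂ * Real.log n * ‖x‖ ^ (2 * (p - 1))) ∧
          TailAndBound P X C₀ r p t (fun x => ‖x‖) (threshIVb C₁ n t)
            (C₂ * Real.log n * threshIVb C₁ n t ^ (2 * (p - 1))) ∧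
          C₂ * Real.log n * threshIVb C₁ n t ^ (2 * (p - 1))
            ≤ C₃ * Real.log n * (1 + t ^ (2 * (p - 1))) ∧
          (1 ≤ t →
            C₂ * Real.log n * threshIVb C₁ n t ^ (2 * (p - 1))
              ≤ C₃ * Real.log n * t ^ (2 * (p - 1)))) := by
  -- The value 192 = 24·8 combines twice the event constant 12 with the constant of
  -- `rpow_mul_log_sum_le`; 100 exceeds 6·14 from regime IVa; 10⁷ exceeds 2·100·192², the largest
  -- constant, also from regime IVa.
  refine ⟨1, 192, 100, 10000000, by norm_num, by norm_num, by norm_num, by norm_num, ?_⟩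
  intro n hn Ω _ P X hX r p t hr hp ht
  exact ⟨fun h => regime_large_p hn hX hr ht h,
    fun h => regime_small_p hn hX hr hp ht h,
    fun h => regime_small_r hn hX hr hp ht h,
    fun hr4 _ hrp hs => regime_critical hn hX ht hr4 hrp hs,
    fun hr4 hr2 hrp hs => regime_critical_euclidean hn hX ht hr4 hr2 hrp hs⟩
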